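/- Let $d \ge 1$, $\mu > -1$, and $s \in \{1,2,3,\dots\}$. Let $\mathbb{B}^d=\{x\in\mathbb{R}^d:\|x\|\le 1\}$ and, for $\nu>-1$, $\varpi_\nu(x)=(1-\|x\|^2)^\nu$ and $$\|g\|_\nu=\Big(b_\nu\int_{\mathbb{B}^d}|g(x)|^2\varpi_\nu(x)\,dx\Big)^{1/2},\qquad b_\nu=\Big(\int_{\mathbb{B}^d}\varpi_\nu(x)\,dx\Big)^{-1}.$$ For a measurable $g:\mathbb{B}^d\to\mathbb{R}$ and $n \in \{0,1,2,\dots\}$ put $E_n(g)_\nu=\inf_p\|g-p\|_\nu$, the infimum being over all real polynomials $p$ in $d$ variables of total degree at most $n$; thus $E_n(g)_\nu=\infty$ if $g\notin L^2(\varpi_\nu,\mathbb{B}^d)$. Let $W_2^{2s}(\varpi_\mu,\mathbb{B}^d)$ be the space of all real $f\in L^2(\varpi_\mu,\mathbb{B}^d)$ whose weak derivatives $\partial^{\mathbf m}f$ in the open unit ball exist and lie in $L^2(\varpi_{\mu+|\mathbf m|},\mathbb{B}^d)$ for all multi-indices $\mathbf m$ with $|\mathbf m|\le 2s$. Let $\Delta=\sum_{i=1}^d\partial_i^2$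 be the Laplace operator and $\Delta_0=\sum_{1\le i<j\le d}(x_i\partial_j-x_j\partial_i)^2$ the Laplace–Beltrami operator of the sphere $\mathbb{S}^{d-1}$, acting in the angular variable (so $\Delta_0=0$ if $d=1$); derivatives are taken in the weak sense. Then there is a constant $c>0$, depending only on $d$, $\mu$ and $s$, such that for all $f\in W_2^{2s}(\varpi_\mu,\mathbb{B}^d)$ and all integers $n\ge 2s$, $$E_n(f)_\mu\le\frac{c}{n^{2s}}\Big[E_{n-2s}(\Delta^sf)_{\mu+2s}+E_n(\Delta_0^sf)_\mu\Big].$$ -/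

import Mathlib

open MeasureTheory

open scoped ENNReal Distributions

noncomputable section

namespace BallApprox

/-- Real Euclidean space of dimension `d`. -/
abbrev Space (d : ℕ) : Type := EuclideanSpace ℝ (Fin d)

/-! ### Weighted `L²` spaces on the unit ball -/

/-- The weight `(1 - ‖x‖²) ^ μ`. -/
def weight {d : ℕ} (μ : ℝ) (x : Space d) : ℝ :=
  (1 - ‖x‖ ^ 2) ^ μ

/-- The measure `(1 - ‖x‖²) ^ μ dx` on the closed unit ball. -/
def weightMeasure (d : ℕ) (μ : ℝ) : Measure (Space d) :=
  (volume.restrict (Metric.closedBall 0 1)).withDensity fun x => ENNReal.ofReal (weight μ x)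

/-- The normalized measure `b_μ (1 - ‖x‖²) ^ μ dx` on the closed unit ball, where
`b_μ = 1 / ∫ (1 - ‖x‖²) ^ μ dx` (the integral is positive and finite for `μ > -1`). -/
def ballMeasure (d : ℕ) (μ : ℝ) : Measure (Space d) :=
  (∫⁻ x in Metric.closedBall (0 : Space d) 1, ENNReal.ofReal (weight μ x))⁻¹ • weightMeasure d μ

/-- The norm `(b_μ ∫ |f|² (1 - ‖x‖²) ^ μ dx) ^ (1/2)`, with value `∞` if the integral diverges. -/
def ballNorm {d : ℕ} (μ : ℝ) (f : Space d → ℝ) : ℝ≥0∞ :=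
  eLpNorm f 2 (ballMeasure d μ)

/-- The error of best approximation of `f` by polynomials of total degree at most `n`
in the norm `ballNorm μ`. It is `∞` if `f` is locally integrable in the open ball and
not in the weighted `L²` space. -/
def bestError {d : ℕ} (n : ℕ) (μ : ℝ) (f : Space d → ℝ) : ℝ≥0∞ :=
  ⨅ (p : MvPolynomial (Fin d) ℝ) (_ : p.totalDegree ≤ n),
    ballNorm μ fun x => f x - MvPolynomial.eval (fun i => x i) p

/-! ### Weak derivatives in the open unit ball -/

/-- The open unit ball. -/
def openBall (d : ℕ) : TopologicalSpace.Opens (Space d) :=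
  ⟨Metric.ball 0 1, Metric.isOpen_ball⟩

/-- The classical partial derivative `∂ᵢ φ`. -/
def classicalPartial {d : ℕ} (i : Fin d) (φ : Space d → ℝ) : Space d → ℝ :=
  fun x => fderiv ℝ φ x (EuclideanSpace.single i 1)

/-- The classical partial derivative `∂₁ ^ m₁ ⋯ ∂_d ^ m_d φ`. -/
def classicalDeriv {d : ℕ} (m : Fin d → ℕ) (φ : Space d → ℝ) : Space d → ℝ :=
  (List.finRange d).foldr (fun i ψ => (classicalPartial i)^[m i] ψ) φ

/-- `g` is the weak partial derivative `∂ ^ m f` in the open unit ball: both functions are locally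
integrable there, and `∫ f ∂ ^ m φ = (-1) ^ |m| ∫ g φ` for all smooth real-valued `φ` with compact
support in the open ball. -/
def HasWeakDeriv {d : ℕ} (m : Fin d → ℕ) (f g : Space d → ℝ) : Prop :=
  LocallyIntegrableOn f (openBall d) volume ∧ LocallyIntegrableOn g (openBall d) volume ∧
    ∀ φ : 𝓓(openBall d, ℝ),
      ∫ x in Metric.ball (0 : Space d) 1, f x * classicalDeriv m φ x =
        (-1) ^ (∑ i, m i) * ∫ x in Metric.ball (0 : Space d) 1, g x * φ x

open Classical in
/-- The weak partial derivative `∂ ^ m f` (unique up to null sets in the open ball); it is set to be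
`0` if `f` has no such weak derivative. -/
def weakDeriv {d : ℕ} (m : Fin d → ℕ) (f : Space d → ℝ) : Space d → ℝ :=
  if h : ∃ g, HasWeakDeriv m f g then h.choose else 0

/-- The Sobolev space of order `r` of all `f` in the `L²` space with weight
`(1 - ‖x‖²) ^ μ` such that, for all multi-indices `m` with `|m| ≤ r`, the weak derivative
`∂ ^ m f` exists and lies in the `L²` space with weight `(1 - ‖x‖²) ^ (μ + |m|)`. -/
def MemSobolevBall {d : ℕ} (r : ℕ) (μ : ℝ) (f : Space d → ℝ) : Prop :=
  MemLp f 2 (ballMeasure d μ) ∧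
    ∀ m : Fin d → ℕ, ∑ i, m i ≤ r →
      ∃ g : Space d → ℝ, HasWeakDeriv m f g ∧ MemLp g 2 (ballMeasure d (μ + ∑ i, (m i : ℝ)))

/-! ### The Laplace and Laplace–Beltrami operators -/

/-- The Laplace operator `∑ᵢ ∂ᵢ²`. -/
def laplace {d : ℕ} (f : Space d → ℝ) : Space d → ℝ :=
  fun x => ∑ i, weakDeriv (Pi.single i 2) f x

/-- The angular derivative `D_{i,j} = xᵢ ∂ⱼ - xⱼ ∂ᵢ`. -/
def angularDeriv {d : ℕ} (i j : Fin d) (f : Space d → ℝ) : Space d → ℝ :=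
  fun x => x i * weakDeriv (Pi.single j 1) f x - x j * weakDeriv (Pi.single i 1) f x

/-- The Laplace–Beltrami operator `∑_{i < j} D_{i,j}²` of the sphere, acting on functions on the
ball in the angular variable. -/
def laplaceBeltrami {d : ℕ} (f : Space d → ℝ) : Space d → ℝ :=
  fun x => ∑ i, ∑ j with i < j, angularDeriv i j (angularDeriv i j f) x

end BallApprox

end

/-! The argument is L² spectral theory on polynomials. Let `P` be the orthogonal projection of `f`
to degree at most `n` for the weight `μ`, let `Q` be its projection to degree at most `N`, where `N
≥ n`, and put `w = Q - P`. Two estimates control `w`.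

Projection: `Δ` from weight `ν` to weight `ν + 2` has a formal adjoint `Δ*` which raises degrees by
at most 2, and `Δ₀` is symmetric and does not raise the degree. Hence `(Δ^s)* p₁` has degree at most
`n` and is orthogonal to `w` when `p₁` has degree at most `n - 2s`, while `(Δ^s)* Δ^s` preserves
every space of polynomials of bounded degree. Therefore `⟨Δ^s f - p₁, Δ^s w⟩ = ‖Δ^s w‖²`, so `‖Δ^s
w‖ ≤ ‖Δ^s f - p₁‖` for every such `p₁`; likewise for `Δ₀^s`. The identities behind this for weak
derivatives are obtained by cutting off near the sphere (`WeakPartial.integral_mul_polyFun`,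
`setIntegral_angular_mul_radial`).

Spectral bound: `(δ n²)^(2s) ‖w‖² ≤ ‖Δ^s w‖² + ‖Δ₀^s w‖²` for `w` orthogonal to degree at most `n`
(`pow_mul_polyInner_le`). Split `w` by degree into orthogonal polynomials. On those of degree `m`
the operator `jacobiOp` is a scalar, and `Δ₀` is diagonalizable. By `laplaceAdjoint_polyLaplace`,
`Δ* Δ` is a polynomial in these two operators, so on a joint eigenvector with `-Δ₀ = l` it is an
explicit product of two factors, each a quadratic in `m` minus `l`. Either `l` is at least of order
`m²`, and `Δ₀^s` is large, or `l` is small, and all the factors from `Δ^s` are of order `m²`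
(`le_laplacePowFactor_add_pow`).

Together these bound `‖Q - P‖` uniformly in `N`; polynomials are dense, so `‖f - P‖` obeys the same
bound. -/

noncomputable section

namespace BallApprox

open MvPolynomial

/-! ### Differential operators on polynomials -/

section PolynomialOperators

variable {d : ℕ}

/-- The real polynomials in `d` variables. -/
abbrev Poly (d : ℕ) : Type := MvPolynomial (Fin d) ℝ

/-- The polynomial `‖x‖²`. -/
def normSqPoly (d : ℕ) : Poly d := ∑ i, X i ^ 2

/-- The Laplace operator on polynomials. -/
def polyLaplace : Poly d →ₗ[ℝ] Poly d :=
  ∑ i, (pderiv i).toLinearMap ∘ₗ (pderiv i).toLinearMap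

/-- The Euler operator `∑ᵢ xᵢ ∂ᵢ` on polynomials. -/
def polyEuler : Poly d →ₗ[ℝ] Poly d :=
  ∑ i, LinearMap.mulLeft ℝ (X i) ∘ₗ (pderiv i).toLinearMap

/-- The angular derivative `xᵢ ∂ⱼ - xⱼ ∂ᵢ` on polynomials. -/
def polyAngular (i j : Fin d) : Poly d →ₗ[ℝ] Poly d :=
  LinearMap.mulLeft ℝ (X i) ∘ₗ (pderiv j).toLinearMap -
    LinearMap.mulLeft ℝ (X j) ∘ₗ (pderiv i).toLinearMap

/-- The Laplace–Beltrami operator on polynomials. -/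
def polyBeltrami : Poly d →ₗ[ℝ] Poly d :=
  ∑ i, ∑ j with i < j, polyAngular i j ∘ₗ polyAngular i j

/-- The adjoint of `∂ᵢ` for the weights `ν` and `ν + 1`. -/
def partialAdjoint (ν : ℝ) (i : Fin d) : Poly d →ₗ[ℝ] Poly d :=
  (2 * (ν + 1)) • LinearMap.mulLeft ℝ (X i) -
    LinearMap.mulLeft ℝ (1 - normSqPoly d) ∘ₗ (pderiv i).toLinearMap

/-- The adjoint of the Laplace operator for the weights `ν` and `ν + 2`. -/
def laplaceAdjoint (ν : ℝ) : Poly d →ₗ[ℝ] Poly d :=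
  ∑ i, partialAdjoint ν i ∘ₗ partialAdjoint (ν + 1) i

/-- The second order operator whose eigenfunctions are the orthogonal polynomials for the
weight `ν`. -/
def jacobiOp (ν : ℝ) : Poly d →ₗ[ℝ] Poly d :=
  polyLaplace - polyEuler ∘ₗ polyEuler - (2 * ν + d) • polyEuler

theorem polyLaplace_apply (p : Poly d) : polyLaplace p = ∑ i, pderiv i (pderiv i p) := by
  simp [polyLaplace]

theorem polyEuler_apply (p : Poly d) : polyEuler p = ∑ i, X i * pderiv i p := by
  simp [polyEuler]

theorem polyAngular_apply (i j : Fin d) (p : Poly d) :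
    polyAngular i j p = X i * pderiv j p - X j * pderiv i p := by
  simp [polyAngular]

theorem partialAdjoint_apply (ν : ℝ) (i : Fin d) (p : Poly d) :
    partialAdjoint ν i p = (2 * (ν + 1)) • (X i * p) - (1 - normSqPoly d) * pderiv i p := by
  simp [partialAdjoint]

theorem laplaceAdjoint_apply (ν : ℝ) (p : Poly d) :
    laplaceAdjoint ν p = ∑ i, partialAdjoint ν i (partialAdjoint (ν + 1) i p) := by
  simp [laplaceAdjoint]

theorem jacobiOp_apply (ν : ℝ) (p : Poly d) :
    jacobiOp ν p = polyLaplace p - polyEuler (polyEuler p) - (2 * ν + d) • polyEuler p := by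
  simp [jacobiOp]

theorem polyBeltrami_apply (p : Poly d) :
    polyBeltrami p = ∑ i, ∑ j with i < j, polyAngular i j (polyAngular i j p) := by
  simp [polyBeltrami]

theorem pderiv_comm (i j : Fin d) (p : Poly d) :
    pderiv i (pderiv j p) = pderiv j (pderiv i p) := by
  have h : ⁅(pderiv i : Derivation ℝ (Poly d) (Poly d)),
      (pderiv j : Derivation ℝ (Poly d) (Poly d))⁆ = 0 := by
    apply MvPolynomial.derivation_ext
    intro k
    by_cases hi : k = i <;> by_cases hj : k = j <;>
      simp [Derivation.commutator_apply, pderiv_X, Pi.single_apply, hi, hj, apply_ite]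
  have := congrArg (fun D => D p) h
  simpa [Derivation.commutator_apply, sub_eq_zero] using this

theorem pderiv_X_eq (i j : Fin d) : pderiv i (X j : Poly d) = if i = j then 1 else 0 := by
  simp [pderiv_X, Pi.single_apply, eq_comm]

theorem pderiv_normSqPoly (i : Fin d) : pderiv i (normSqPoly d) = (2 : ℝ) • X i := by
  simp only [normSqPoly, pow_two, map_sum, Derivation.leibniz, smul_eq_mul, pderiv_X_eq, mul_ite,
    mul_one, mul_zero, Finset.sum_add_distrib, Finset.sum_ite_eq, Finset.mem_univ, if_true,
    two_smul]

theorem polyEuler_mul (p q : Poly d) :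
    polyEuler (p * q) = polyEuler p * q + p * polyEuler q := by
  simp only [polyEuler_apply, Derivation.leibniz, smul_eq_mul, Finset.sum_mul, Finset.mul_sum,
    ← Finset.sum_add_distrib]
  exact Finset.sum_congr rfl fun i _ => by ring

theorem polyEuler_normSqPoly : polyEuler (normSqPoly d) = (2 : ℝ) • normSqPoly d := by
  simp only [polyEuler_apply, pderiv_normSqPoly]
  rw [normSqPoly, Finset.smul_sum]
  exact Finset.sum_congr rfl fun i _ => by rw [mul_smul_comm, pow_two]

theorem polyLaplace_normSqPoly_mul (p : Poly d) :
    polyLaplace (normSqPoly d * p) =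
      normSqPoly d * polyLaplace p + (4 : ℝ) • polyEuler p + (2 * d : ℝ) • p := by
  have h : ∀ i : Fin d, pderiv i (pderiv i (normSqPoly d * p)) =
      normSqPoly d * pderiv i (pderiv i p) + (4 : ℝ) • (X i * pderiv i p) + (2 : ℝ) • p :=
      fun i => by
    rw [Derivation.leibniz, map_add, smul_eq_mul, smul_eq_mul, Derivation.leibniz,
      Derivation.leibniz, pderiv_normSqPoly, Derivation.map_smul, pderiv_X_eq, if_pos rfl]
    simp only [MvPolynomial.smul_eq_C_mul, map_ofNat, smul_eq_mul]
    ring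
  simp only [polyLaplace_apply, polyEuler_apply, h, Finset.sum_add_distrib, Finset.mul_sum,
    ← Finset.smul_sum]
  simp [MvPolynomial.smul_eq_C_mul, mul_assoc, mul_left_comm]

theorem polyLaplace_polyEuler (p : Poly d) :
    polyLaplace (polyEuler p) = polyEuler (polyLaplace p) + (2 : ℝ) • polyLaplace p := by
  have h : ∀ i j : Fin d, pderiv i (pderiv i (X j * pderiv j p)) =
      X j * pderiv j (pderiv i (pderiv i p)) +
        (2 : ℝ) • (if i = j then pderiv i (pderiv i p) else 0) := fun i j => by
    simp only [Derivation.leibniz, smul_eq_mul, map_add, pderiv_X_eq]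
    rw [pderiv_comm j i, pderiv_comm j i]
    split_ifs with h
    · subst h
      simp only [Derivation.map_one_eq_zero, MvPolynomial.smul_eq_C_mul, map_ofNat]
      ring
    · simp
  simp only [polyLaplace_apply, polyEuler_apply, map_sum]
  rw [Finset.sum_comm]
  simp only [h, Finset.sum_add_distrib, ← Finset.smul_sum, Finset.sum_ite_eq,
    Finset.mem_univ, if_true]

/-- Replaces the sum over `i < j` in the Laplace–Beltrami operator by a full double sum, which can
be expanded freely. -/
theorem sum_sum_eq_two_nsmul_sum_lt {ι M : Type*} [Fintype ι] [LinearOrder ι] [AddCommMonoid M]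
    (F : ι → ι → M) (h₀ : ∀ i, F i i = 0) (hs : ∀ i j, F i j = F j i) :
    ∑ i, ∑ j, F i j = 2 • ∑ i, ∑ j with i < j, F i j := by
  have h : ∀ i j, F i j = (if i < j then F i j else 0) + (if j < i then F j i else 0) :=
    fun i j => by
    rcases lt_trichotomy i j with hij | rfl | hij
    · simp [hij, hij.not_gt]
    · simp [h₀]
    · simp [hij, hij.not_gt, hs i j]
  have h₂ : ∑ i, ∑ j, F i j =
      ∑ i, ∑ j, ((if i < j then F i j else 0) + (if j < i then F j i else 0)) :=
    Finset.sum_congr rfl fun i _ => Finset.sum_congr rfl fun j _ => h i j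
  rw [h₂]
  simp only [Finset.sum_add_distrib, Finset.sum_filter, two_nsmul]
  congr 1
  exact Finset.sum_comm

theorem polyAngular_polyAngular (i j : Fin d) (p : Poly d) :
    polyAngular i j (polyAngular i j p) =
      X i ^ 2 * pderiv j (pderiv j p) + X j ^ 2 * pderiv i (pderiv i p) -
        (2 : ℝ) • (X i * X j * pderiv i (pderiv j p)) - X i * pderiv i p - X j * pderiv j p +
        (2 : ℝ) • (if i = j then X i * pderiv i p else 0) := by
  simp only [polyAngular_apply, map_sub, Derivation.leibniz, smul_eq_mul, pderiv_X_eq,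
    pderiv_comm j i]
  by_cases h : i = j
  · subst h
    simp only [MvPolynomial.smul_eq_C_mul, map_ofNat, if_true]
    ring
  · simp only [MvPolynomial.smul_eq_C_mul, map_ofNat, if_true, h, Ne.symm h, if_false]
    ring

theorem polyEuler_polyEuler (p : Poly d) :
    polyEuler (polyEuler p) =
      ∑ i, ∑ j, X i * X j * pderiv i (pderiv j p) + polyEuler p := by
  have h : ∀ i j : Fin d, X i * pderiv i (X j * pderiv j p) =
      X i * X j * pderiv i (pderiv j p) + (if i = j then X i * pderiv i p else 0) :=
      fun i j => by
    rw [Derivation.leibniz, pderiv_X_eq]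
    split_ifs with hij
    · subst hij; simp only [smul_eq_mul]; ring
    · simp only [smul_eq_mul]; ring
  simp only [polyEuler_apply, map_sum]
  rw [Finset.sum_comm]
  simp only [h, Finset.sum_add_distrib, Finset.sum_ite_eq, Finset.mem_univ, if_true]

/-- This is the Laplacian in polar coordinates, with the Euler operator as radial derivative. It
reduces later identities to the commutation rules of `‖x‖²`, `Δ` and the Euler operator. -/
theorem polyBeltrami_eq (p : Poly d) :
    polyBeltrami p = normSqPoly d * polyLaplace p - polyEuler (polyEuler p) -
      (d - 2 : ℝ) • polyEuler p := by
  have h := sum_sum_eq_two_nsmul_sum_lt (fun i j : Fin d => polyAngular i j (polyAngular i j p))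
    (fun i => by simp [polyAngular_apply])
    (fun i j => by
      rw [show polyAngular i j = -polyAngular j i by simp [polyAngular]]; simp)
  rw [← polyBeltrami_apply] at h
  have h₂ : (2 : ℝ) • polyBeltrami p = (2 : ℝ) • (normSqPoly d * polyLaplace p -
      polyEuler (polyEuler p) - (d - 2 : ℝ) • polyEuler p) := by
    rw [ofNat_smul_eq_nsmul ℝ 2, ← h, polyEuler_polyEuler, polyLaplace_apply, polyEuler_apply,
      normSqPoly]
    simp only [polyAngular_polyAngular, Finset.sum_add_distrib, Finset.sum_sub_distrib,
      ← Finset.smul_sum, Finset.sum_ite_eq, Finset.mem_univ, if_true, Finset.sum_mul_sum,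
      Finset.sum_const, Finset.card_univ, Fintype.card_fin]
    rw [Finset.sum_comm (f := fun i j : Fin d => X j ^ 2 * pderiv i (pderiv i p))]
    simp only [MvPolynomial.smul_eq_C_mul, map_ofNat, map_sub, map_natCast, nsmul_eq_mul,
      ← Finset.mul_sum]
    ring
  exact smul_right_injective _ (two_ne_zero (α := ℝ)) h₂

theorem polyBeltrami_polyLaplace (p : Poly d) :
    polyBeltrami (polyLaplace p) = polyLaplace (polyBeltrami p) := by
  simp only [polyBeltrami_eq, map_sub, map_add, polyLaplace_normSqPoly_mul, polyLaplace_polyEuler,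
    map_smul]
  simp only [MvPolynomial.smul_eq_C_mul, map_natCast, map_ofNat, map_mul, map_sub]
  ring

/-- An intertwining relation: the shift is exactly what turns the eigenvalue of degree `m` and
weight `ν` into that of degree `m - 2` and weight `ν + 2`, so it makes induction on powers of `Δ`
possible. -/
theorem jacobiOp_polyLaplace (ν : ℝ) (p : Poly d) :
    jacobiOp (ν + 2) (polyLaplace p) =
      polyLaplace (jacobiOp ν p) + (4 + 4 * ν + 2 * d) • polyLaplace p := by
  simp only [jacobiOp_apply, map_sub, map_add, polyLaplace_polyEuler, map_smul]
  simp only [MvPolynomial.smul_eq_C_mul, map_natCast, map_ofNat, map_mul, map_add]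
  ring

/-- Writes `jacobiOp` as `Δ₀ - ∑ ∂ᵢ* ∂ᵢ`, a form from which its symmetry is visible. -/
theorem sum_partialAdjoint_pderiv (ν : ℝ) (p : Poly d) :
    ∑ i, partialAdjoint ν i (pderiv i p) = polyBeltrami p - jacobiOp ν p := by
  have : ∑ i, partialAdjoint ν i (pderiv i p) =
      (2 * (ν + 1)) • polyEuler p - (1 - normSqPoly d) * polyLaplace p := by
    simp only [partialAdjoint_apply, polyEuler_apply, polyLaplace_apply, Finset.sum_sub_distrib,
      Finset.mul_sum, Finset.smul_sum]
  rw [this, polyBeltrami_eq, jacobiOp_apply]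
  simp only [MvPolynomial.smul_eq_C_mul, map_natCast, map_ofNat, map_mul, map_sub, map_add,
    map_one]
  ring

theorem laplaceAdjoint_eq (ν : ℝ) (p : Poly d) :
    laplaceAdjoint ν p = (1 - normSqPoly d) ^ 2 * polyLaplace p -
      (4 * (ν + 2)) • ((1 - normSqPoly d) * polyEuler p) +
      (4 * (ν + 2) * (ν + 1)) • (normSqPoly d * p) -
      (2 * d * (ν + 2)) • ((1 - normSqPoly d) * p) := by
  have h : ∀ i : Fin d, partialAdjoint ν i (partialAdjoint (ν + 1) i p) =
      (1 - normSqPoly d) ^ 2 * pderiv i (pderiv i p) -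
      (4 * (ν + 2)) • ((1 - normSqPoly d) * (X i * pderiv i p)) +
      (4 * (ν + 2) * (ν + 1)) • (X i ^ 2 * p) -
      (2 * (ν + 2)) • ((1 - normSqPoly d) * p) := fun i => by
    simp only [partialAdjoint_apply, map_sub, map_smul, Derivation.leibniz, smul_eq_mul,
      pderiv_X_eq, if_true, pderiv_normSqPoly, Derivation.map_one_eq_zero]
    simp only [MvPolynomial.smul_eq_C_mul, map_ofNat, map_mul, map_add, map_one]
    ring
  simp only [laplaceAdjoint_apply, h, Finset.sum_add_distrib, Finset.sum_sub_distrib,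
    ← Finset.smul_sum, ← Finset.mul_sum, ← Finset.sum_mul, Finset.sum_const, Finset.card_univ,
    Fintype.card_fin]
  rw [polyLaplace_apply, polyEuler_apply, ← normSqPoly]
  simp only [MvPolynomial.smul_eq_C_mul, map_natCast, map_ofNat, map_mul, map_add, map_one,
    nsmul_eq_mul]
  ring

/-- The central algebraic identity: `Δ* Δ` is a polynomial in `jacobiOp` and `Δ₀`, hence acts as a
scalar on their joint eigenvectors. -/
theorem laplaceAdjoint_polyLaplace (ν : ℝ) (p : Poly d) :
    laplaceAdjoint ν (polyLaplace p) =
      jacobiOp ν (jacobiOp ν p) + polyBeltrami (polyBeltrami p)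
        - (2 : ℝ) • jacobiOp ν (polyBeltrami p) -
        ((d - 2) * (2 * ν + 2)) • jacobiOp ν p +
        ((2 * ν + 2) * (2 * ν + d)) • polyBeltrami p := by
  rw [laplaceAdjoint_eq]
  simp only [polyBeltrami_eq, jacobiOp_apply, map_sub, map_add, polyLaplace_normSqPoly_mul,
    polyEuler_mul, polyEuler_normSqPoly, polyLaplace_polyEuler, map_smul, smul_mul_assoc]
  simp only [MvPolynomial.smul_eq_C_mul, map_natCast, map_ofNat, map_mul, map_sub, map_add,
    map_one]
  ring

end PolynomialOperators

/-! ### Degrees -/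

section Degrees

variable {d : ℕ}

/-- The space of polynomials of total degree at most `m`. -/
abbrev PolyLE (d m : ℕ) : Submodule ℝ (Poly d) := restrictTotalDegree (Fin d) ℝ m

theorem mem_polyLE {m : ℕ} {p : Poly d} : p ∈ PolyLE d m ↔ p.totalDegree ≤ m :=
  mem_restrictTotalDegree _ _ _

theorem polyLE_mono {m n : ℕ} (h : m ≤ n) : PolyLE d m ≤ PolyLE d n := fun _ hp =>
  mem_polyLE.2 ((mem_polyLE.1 hp).trans h)

theorem mul_mem_polyLE {m n : ℕ} {p q : Poly d} (hp : p ∈ PolyLE d m) (hq : q ∈ PolyLE d n) :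
    p * q ∈ PolyLE d (m + n) :=
  mem_polyLE.2 ((totalDegree_mul p q).trans (add_le_add (mem_polyLE.1 hp) (mem_polyLE.1 hq)))

theorem mem_polyLE_of_forall_monomial {m k : ℕ} (T : Poly d →ₗ[ℝ] Poly d)
    (hT : ∀ s : Fin d →₀ ℕ, s.degree ≤ m → T (monomial s 1) ∈ PolyLE d k) {p : Poly d}
    (hp : p ∈ PolyLE d m) : T p ∈ PolyLE d k := by
  have hle : PolyLE d m ≤ (PolyLE d k).comap T := by
    rw [PolyLE, restrictTotalDegree, restrictSupport_eq_span, Submodule.span_le]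
    rintro _ ⟨s, hs, rfl⟩
    exact hT s hs
  exact hle hp

theorem monomial_mem_polyLE {m : ℕ} {s : Fin d →₀ ℕ} (hs : s.degree ≤ m) (a : ℝ) :
    (monomial s a : Poly d) ∈ PolyLE d m :=
  mem_polyLE.2 ((totalDegree_monomial_le s a).trans hs)

theorem pderiv_mem_polyLE {m : ℕ} (i : Fin d) {p : Poly d} (hp : p ∈ PolyLE d m) :
    pderiv i p ∈ PolyLE d (m - 1) := by
  refine mem_polyLE_of_forall_monomial (pderiv i).toLinearMap (fun s hs => ?_) hp
  show pderiv i (monomial s 1) ∈ _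
  rw [pderiv_monomial]
  by_cases h : s i = 0
  · simp [h]
  · refine monomial_mem_polyLE ?_ _
    have h₁ : Finsupp.single i 1 ≤ s := by
      rw [Finsupp.single_le_iff]; omega
    have h₂ := congrArg Finsupp.degree (tsub_add_cancel_of_le h₁)
    rw [map_add, Finsupp.degree_single] at h₂
    omega

theorem X_mul_pderiv_mem_polyLE {m : ℕ} (i j : Fin d) {p : Poly d} (hp : p ∈ PolyLE d m) :
    X i * pderiv j p ∈ PolyLE d m := by
  have hX : (X i : Poly d) ∈ PolyLE d 1 := mem_polyLE.2 (totalDegree_X i).le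
  rcases m with _ | m
  · rw [totalDegree_eq_zero_iff_eq_C.1 (Nat.le_zero.1 (mem_polyLE.1 hp))]
    simp
  · rw [add_comm m 1]
    exact mul_mem_polyLE hX (by simpa using pderiv_mem_polyLE j hp)

theorem polyAngular_mem_polyLE {m : ℕ} (i j : Fin d) {p : Poly d} (hp : p ∈ PolyLE d m) :
    polyAngular i j p ∈ PolyLE d m := by
  rw [polyAngular_apply]
  exact sub_mem (X_mul_pderiv_mem_polyLE i j hp) (X_mul_pderiv_mem_polyLE j i hp)

theorem polyBeltrami_mem_polyLE {m : ℕ} {p : Poly d} (hp : p ∈ PolyLE d m) :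
    polyBeltrami p ∈ PolyLE d m := by
  rw [polyBeltrami_apply]
  exact sum_mem fun i _ => sum_mem fun j _ =>
    polyAngular_mem_polyLE i j (polyAngular_mem_polyLE i j hp)

theorem polyEuler_mem_polyLE {m : ℕ} {p : Poly d} (hp : p ∈ PolyLE d m) :
    polyEuler p ∈ PolyLE d m := by
  rw [polyEuler_apply]
  exact sum_mem fun i _ => X_mul_pderiv_mem_polyLE i i hp

theorem polyLaplace_mem_polyLE {m : ℕ} {p : Poly d} (hp : p ∈ PolyLE d m) :
    polyLaplace p ∈ PolyLE d (m - 2) := by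
  rw [polyLaplace_apply]
  exact sum_mem fun i _ => pderiv_mem_polyLE i (pderiv_mem_polyLE i hp)

theorem polyLaplace_iterate_mem_polyLE {m : ℕ} (s : ℕ) {p : Poly d} (hp : p ∈ PolyLE d m) :
    polyLaplace^[s] p ∈ PolyLE d (m - 2 * s) := by
  induction s with
  | zero => simpa using hp
  | succ s ih =>
    rw [Function.iterate_succ_apply', show m - 2 * (s + 1) = m - 2 * s - 2 by omega]
    exact polyLaplace_mem_polyLE ih

theorem polyBeltrami_iterate_mem_polyLE {m : ℕ} (s : ℕ) {p : Poly d} (hp : p ∈ PolyLE d m) :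
    polyBeltrami^[s] p ∈ PolyLE d m := by
  induction s with
  | zero => simpa using hp
  | succ s ih =>
    rw [Function.iterate_succ_apply']
    exact polyBeltrami_mem_polyLE ih

theorem partialAdjoint_mem_polyLE {m : ℕ} (ν : ℝ) (i : Fin d) {p : Poly d}
    (hp : p ∈ PolyLE d m) : partialAdjoint ν i p ∈ PolyLE d (m + 1) := by
  have hX : ∀ i, (X i : Poly d) ∈ PolyLE d 1 := fun i => mem_polyLE.2 (totalDegree_X i).le
  have h₁ : (1 : Poly d) ∈ PolyLE d 0 := mem_polyLE.2 totalDegree_one.le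
  rw [partialAdjoint_apply]
  refine sub_mem (Submodule.smul_mem _ _ ?_) ?_
  · rw [add_comm m 1]; exact mul_mem_polyLE (hX i) hp
  · rw [sub_mul, one_mul]
    refine sub_mem (polyLE_mono (by omega) (pderiv_mem_polyLE i hp)) ?_
    rw [normSqPoly, Finset.sum_mul]
    refine sum_mem fun j _ => ?_
    rw [pow_two, mul_assoc, add_comm m 1]
    exact mul_mem_polyLE (hX j) (X_mul_pderiv_mem_polyLE j i hp)

theorem laplaceAdjoint_mem_polyLE {m : ℕ} (ν : ℝ) {p : Poly d} (hp : p ∈ PolyLE d m) :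
    laplaceAdjoint ν p ∈ PolyLE d (m + 2) := by
  rw [laplaceAdjoint_apply]
  exact sum_mem fun i _ => partialAdjoint_mem_polyLE _ i (partialAdjoint_mem_polyLE _ i hp)

/-- The adjoint of the `s`-th power of the Laplace operator for the weights `ν` and `ν + 2 s`. -/
def laplacePowAdjoint : ℕ → ℝ → Poly d →ₗ[ℝ] Poly d
  | 0, _ => LinearMap.id
  | s + 1, ν => laplaceAdjoint ν ∘ₗ laplacePowAdjoint s (ν + 2)

theorem laplacePowAdjoint_mem_polyLE {m : ℕ} (s : ℕ) (ν : ℝ) {p : Poly d} (hp : p ∈ PolyLE d m) :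
    laplacePowAdjoint s ν p ∈ PolyLE d (m + 2 * s) := by
  induction s generalizing ν with
  | zero => simpa [laplacePowAdjoint] using hp
  | succ s ih =>
    rw [show m + 2 * (s + 1) = m + 2 * s + 2 by ring]
    exact laplaceAdjoint_mem_polyLE ν (ih (ν + 2))

theorem polyEuler_monomial (s : Fin d →₀ ℕ) (a : ℝ) :
    polyEuler (monomial s a : Poly d) = (s.degree : ℝ) • monomial s a := by
  simp only [polyEuler_apply, X_mul_pderiv_monomial]
  rw [← Finset.sum_smul, Finsupp.degree_eq_sum, Nat.cast_smul_eq_nsmul]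

theorem polyEuler_sub_smul_mem_polyLE {m : ℕ} (hm : 1 ≤ m) {p : Poly d} (hp : p ∈ PolyLE d m) :
    polyEuler p - (m : ℝ) • p ∈ PolyLE d (m - 1) := by
  refine mem_polyLE_of_forall_monomial (polyEuler - (m : ℝ) • LinearMap.id) (fun s hs => ?_) hp
  simp only [LinearMap.sub_apply, LinearMap.smul_apply, LinearMap.id_apply, polyEuler_monomial]
  rcases hs.lt_or_eq with h | h
  · have := monomial_mem_polyLE (show s.degree ≤ m - 1 by omega) (1 : ℝ)
    exact sub_mem (Submodule.smul_mem _ _ this) (Submodule.smul_mem _ _ this)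
  · simp [h]

theorem jacobiOp_mem_polyLE {m : ℕ} (ν : ℝ) {p : Poly d} (hp : p ∈ PolyLE d m) :
    jacobiOp ν p ∈ PolyLE d m := by
  rw [jacobiOp_apply]
  exact sub_mem (sub_mem (polyLE_mono (by omega) (polyLaplace_mem_polyLE hp))
    (polyEuler_mem_polyLE (polyEuler_mem_polyLE hp)))
    (Submodule.smul_mem _ _ (polyEuler_mem_polyLE hp))

/-- On the leading homogeneous part the Euler operator is multiplication by `m`, and `Δ` contributes
only lower degrees. So `jacobiOp` is triangular with respect to degree. -/
theorem jacobiOp_add_smul_mem_polyLE {m : ℕ} (hm : 1 ≤ m) (ν : ℝ) {p : Poly d}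
    (hp : p ∈ PolyLE d m) :
    jacobiOp ν p + ((m : ℝ) * (m + 2 * ν + d)) • p ∈ PolyLE d (m - 1) := by
  have h := polyEuler_sub_smul_mem_polyLE hm hp
  have h₂ : jacobiOp ν p + ((m : ℝ) * (m + 2 * ν + d)) • p =
      polyLaplace p - polyEuler (polyEuler p - (m : ℝ) • p) -
        ((m : ℝ) + 2 * ν + d) • (polyEuler p - (m : ℝ) • p) := by
    rw [jacobiOp_apply, map_sub, map_smul]
    module
  rw [h₂]
  exact sub_mem (sub_mem (polyLE_mono (by omega) (polyLaplace_mem_polyLE hp))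
    (polyEuler_mem_polyLE h)) (Submodule.smul_mem _ _ h)

end Degrees

/-! ### Joint eigenpolynomials -/

section Eigen

variable {d : ℕ}

/-- The eigenvalue of `Δ* Δ` on polynomials of degree `x` orthogonal, for the weight `ν`, to those
of lower degree, on which `-Δ₀` acts as `l`. -/
def laplaceFactor (d : ℕ) (x ν l : ℝ) : ℝ :=
  (x * (x + d - 2) - l) * ((x + 2 * ν + 2) * (x + 2 * ν + d) - l)

/-- The eigenvalue of `(Δ ^ s)* Δ ^ s`. -/
def laplacePowFactor (d : ℕ) : ℕ → ℝ → ℝ → ℝ → ℝ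
  | 0, _, _, _ => 1
  | s + 1, x, ν, l => laplaceFactor d x ν l * laplacePowFactor d s (x - 2) (ν + 2) l

/-- Inserting the two eigenvalues gives a quadratic in `l`, which splits into linear factors. -/
theorem laplaceAdjoint_polyLaplace_of_eigen {x ν l : ℝ} {p : Poly d}
    (hJ : jacobiOp ν p = -(x * (x + 2 * ν + d)) • p) (hB : polyBeltrami p = -l • p) :
    laplaceAdjoint ν (polyLaplace p) = laplaceFactor d x ν l • p := by
  rw [laplaceAdjoint_polyLaplace]
  simp only [hJ, hB, map_smul, smul_smul, laplaceFactor]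
  module

/-- By the intertwining relations `Δ p` is again a joint eigenvector, with `x - 2`, `ν + 2` and the
same `l`. -/
theorem laplacePowAdjoint_polyLaplace_of_eigen (s : ℕ) {x ν l : ℝ} {p : Poly d}
    (hJ : jacobiOp ν p = -(x * (x + 2 * ν + d)) • p) (hB : polyBeltrami p = -l • p) :
    laplacePowAdjoint s ν (polyLaplace^[s] p) = laplacePowFactor d s x ν l • p := by
  induction s generalizing x ν p with
  | zero => simp [laplacePowAdjoint, laplacePowFactor]
  | succ s ih =>
    have h := ih (x := x - 2) (ν := ν + 2) (p := polyLaplace p)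
      (by rw [jacobiOp_polyLaplace, hJ, map_smul]; module)
      (by rw [polyBeltrami_polyLaplace, hB, map_smul])
    rw [Function.iterate_succ_apply, laplacePowAdjoint, LinearMap.comp_apply, h, map_smul,
      laplaceAdjoint_polyLaplace_of_eigen hJ hB, smul_smul, laplacePowFactor, mul_comm]

theorem polyBeltrami_iterate_of_eigen (s : ℕ) {l : ℝ} {p : Poly d}
    (hB : polyBeltrami p = -l • p) : polyBeltrami^[s] p = (-l) ^ s • p := by
  induction s with
  | zero => simp
  | succ s ih => rw [Function.iterate_succ_apply', ih, map_smul, hB, smul_smul, pow_succ]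

theorem pow_le_laplacePowFactor {b l : ℝ} (hb : 0 ≤ b) (s : ℕ) (x ν : ℝ)
    (h : ∀ i < s, b ≤ laplaceFactor d (x - 2 * i) (ν + 2 * i) l) :
    b ^ s ≤ laplacePowFactor d s x ν l := by
  induction s generalizing x ν with
  | zero => simp [laplacePowFactor]
  | succ s ih =>
    have h₀ : b ≤ laplaceFactor d x ν l := by simpa using h 0 s.succ_pos
    have h₁ := ih (x - 2) (ν + 2) fun i hi => by
      have := h (i + 1) (by omega)
      push_cast at this
      convert this using 2 <;> ring
    rw [pow_succ', laplacePowFactor]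
    exact mul_le_mul h₀ h₁ (pow_nonneg hb s) (hb.trans h₀)

/-- The constant in the spectral lower bound. -/
def spectralConst (s : ℕ) : ℝ := (3 / (2 * s + 1)) ^ 2 / 4

theorem spectralConst_pos (s : ℕ) : 0 < spectralConst s := by
  unfold spectralConst; positivity

/-- Compare `l` with `b = δ m²`. If `l ≥ b`, the power of `l` suffices, the other term being
nonnegative; if `l ≤ b`, each of the `2s` linear factors is at least `b`. -/
theorem le_laplacePowFactor_add_pow (hd : 1 ≤ d) {ν : ℝ} (hν : -1 < ν) {s m : ℕ} (hs : 1 ≤ s)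
    (hm : 2 * s + 1 ≤ m) {l : ℝ} (hR : 0 ≤ laplacePowFactor d s m ν l) :
    (spectralConst s * (m : ℝ) ^ 2) ^ (2 * s) ≤ laplacePowFactor d s m ν l + l ^ (2 * s) := by
  set b := spectralConst s * (m : ℝ) ^ 2 with hbdef
  have hb : 0 ≤ b := by have := spectralConst_pos s; positivity
  rcases le_total b l with hl | hl
  · have := pow_le_pow_left₀ hb hl (2 * s)
    linarith
  · have h : (b ^ 2) ^ s ≤ laplacePowFactor d s m ν l := by
      refine pow_le_laplacePowFactor (by positivity) s m ν fun i hi => ?_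
      have hd' : (1 : ℝ) ≤ d := by exact_mod_cast hd
      have hi' : (i : ℝ) + 1 ≤ s := by exact_mod_cast hi
      have hm' : 2 * (s : ℝ) + 1 ≤ m := by exact_mod_cast hm
      have hi0 : (0 : ℝ) ≤ i := i.cast_nonneg
      set y : ℝ := m - 2 * i with hy
      have hy3 : 3 ≤ y := by linarith
      -- As `i ≤ s - 1`, the ratio `(m - 2i) / m` is at least `(m - 2s + 2) / m`, which is smallest
      -- at `m = 2s + 1`. This is the source of the fraction in `spectralConst`.
      have hθ : 3 / (2 * (s : ℝ) + 1) * m ≤ y := by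
        rw [div_mul_eq_mul_div, div_le_iff₀ (by positivity)]
        nlinarith
      have hθ0 : 0 ≤ 3 / (2 * (s : ℝ) + 1) * m := by positivity
      have hyb : 2 * b ≤ 2 / 3 * y ^ 2 := by
        have := pow_le_pow_left₀ hθ0 hθ 2
        rw [hbdef, spectralConst]
        nlinarith
      -- Since `d ≥ 1` and `z ≥ y ≥ 3`, one has `z (z + d - 2) ≥ z (z - 1) ≥ (2/3) z² ≥ 2 b`, and `l
      -- ≤ b`. The two factors correspond to `z = y` and to a second `z`, which is at least `y`
      -- because `ν > -1`.
      have key : ∀ z : ℝ, y ≤ z → b ≤ z * (z + d - 2) - l := fun z hz => by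
        nlinarith
      have h₁ := key y le_rfl
      have h₂ := key (y + 2 * (ν + 2 * i) + 2) (by linarith)
      rw [laplaceFactor, pow_two]
      refine mul_le_mul h₁ ?_ hb (hb.trans h₁)
      calc b ≤ _ := h₂
        _ = _ := by ring
    rw [pow_mul]
    have : 0 ≤ l ^ (2 * s) := by rw [pow_mul]; positivity
    linarith

end Eigen

/-! ### The weighted measures -/

section Measures

variable {d : ℕ}

theorem one_sub_normSq_pos {x : Space d} (hx : x ∈ Metric.ball (0 : Space d) 1) :
    0 < 1 - ‖x‖ ^ 2 := by
  rw [mem_ball_zero_iff] at hx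
  nlinarith [norm_nonneg x]

theorem weight_pos (ν : ℝ) {x : Space d} (hx : x ∈ Metric.ball (0 : Space d) 1) :
    0 < weight ν x :=
  Real.rpow_pos_of_pos (one_sub_normSq_pos hx) _

theorem measurable_weight (ν : ℝ) : Measurable (weight ν : Space d → ℝ) := by
  unfold weight; fun_prop

theorem closedBall_ae_eq_ball :
    (Metric.closedBall (0 : Space d) 1 : Set (Space d)) =ᵐ[volume] Metric.ball 0 1 := by
  have h : volume (Metric.sphere (0 : Space d) 1) = 0 :=
    Measure.addHaar_sphere_of_ne_zero _ _ one_ne_zero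
  rw [← Metric.ball_union_sphere]
  exact union_ae_eq_left_of_ae_eq_empty (ae_eq_empty.2 h)

theorem weightMeasure_eq (ν : ℝ) : weightMeasure d ν =
    (volume.restrict (Metric.ball 0 1)).withDensity fun x => ENNReal.ofReal (weight ν x) := by
  rw [weightMeasure, Measure.restrict_congr_set closedBall_ae_eq_ball]

theorem weightMeasure_absolutelyContinuous (ν : ℝ) :
    weightMeasure d ν ≪ volume.restrict (Metric.ball 0 1) := by
  rw [weightMeasure_eq]
  exact withDensity_absolutelyContinuous _ _

/-- With the converse above, all the weighted measures have the same null sets, so almost-everywhere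
statements and measurability pass between weights. -/
theorem absolutelyContinuous_weightMeasure (ν : ℝ) :
    volume.restrict (Metric.ball (0 : Space d) 1) ≪ weightMeasure d ν := by
  rw [weightMeasure_eq]
  refine withDensity_absolutelyContinuous' (measurable_weight ν).ennreal_ofReal.aemeasurable ?_
  filter_upwards [ae_restrict_mem measurableSet_ball] with x hx
  simpa using weight_pos ν hx

theorem ae_mem_ball (ν : ℝ) : ∀ᵐ x ∂weightMeasure d ν, x ∈ Metric.ball (0 : Space d) 1 :=
  (weightMeasure_absolutelyContinuous ν).ae_le (ae_restrict_mem measurableSet_ball)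

theorem integral_weightMeasure (ν : ℝ) (g : Space d → ℝ) :
    ∫ x, g x ∂weightMeasure d ν = ∫ x in Metric.ball (0 : Space d) 1, weight ν x * g x := by
  rw [weightMeasure_eq, integral_withDensity_eq_integral_toReal_smul
    (measurable_weight ν).ennreal_ofReal (by simp)]
  refine setIntegral_congr_fun measurableSet_ball fun x hx => ?_
  simp [ENNReal.toReal_ofReal (weight_pos ν hx).le]

theorem weightMeasure_anti {ν ν' : ℝ} (h : ν ≤ ν') : weightMeasure d ν' ≤ weightMeasure d ν := by
  simp only [weightMeasure_eq]
  refine withDensity_mono ?_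
  filter_upwards [ae_restrict_mem measurableSet_ball] with x hx
  exact ENNReal.ofReal_le_ofReal (Real.rpow_le_rpow_of_exponent_ge (one_sub_normSq_pos hx)
    (by nlinarith [norm_nonneg x]) h)

/-- In polar coordinates the only singular factor is `(1 - r) ^ ν`, integrable at 1 exactly because
`ν > -1`; the remaining factor is continuous on `[0, 1]`. -/
theorem integrableOn_weight [NeZero d] {ν : ℝ} (hν : -1 < ν) :
    IntegrableOn (weight ν) (Metric.ball (0 : Space d) 1) := by
  refine (integrableOn_fun_norm_addHaar (E := Space d) volume
    (f := fun r : ℝ => (1 - r ^ 2) ^ ν)).2 ?_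
  have h₁ : IntegrableOn (fun r : ℝ => (1 - r) ^ ν) (Set.Ioo 0 1) := by
    have := (intervalIntegral.intervalIntegrable_rpow' (a := 0) (b := 1) hν).comp_sub_left 1
    rw [sub_self, sub_zero] at this
    have h := (intervalIntegrable_iff_integrableOn_Ioc_of_le zero_le_one).1 this.symm
    exact h.mono_set Set.Ioo_subset_Ioc_self
  have h₂ : ∀ r ∈ Set.Ioo (0 : ℝ) 1,
      r ^ (Module.finrank ℝ (Space d) - 1) • (1 - r ^ 2) ^ ν =
        (1 - r) ^ ν * (r ^ (Module.finrank ℝ (Space d) - 1) * (1 + r) ^ ν) := fun r hr => by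
    rw [show 1 - r ^ 2 = (1 - r) * (1 + r) by ring,
      Real.mul_rpow (by linarith [hr.2]) (by linarith [hr.1]), smul_eq_mul]
    ring
  rw [integrableOn_congr_fun h₂ measurableSet_Ioo]
  have hc : ContinuousOn (fun r : ℝ => r ^ (Module.finrank ℝ (Space d) - 1) * (1 + r) ^ ν)
      (Set.Icc 0 1) := by
    refine (continuousOn_pow _).mul (ContinuousOn.rpow_const (by fun_prop) fun r hr => ?_)
    exact Or.inl (by linarith [hr.1])
  obtain ⟨C, hC⟩ := isCompact_Icc.exists_bound_of_continuousOn hc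
  refine Integrable.mul_bdd (c := C) h₁ ?_ ?_
  · exact (hc.mono Set.Ioo_subset_Icc_self).aestronglyMeasurable measurableSet_Ioo
  · filter_upwards [ae_restrict_mem measurableSet_Ioo] with r hr
    exact hC r (Set.Ioo_subset_Icc_self hr)

theorem isFiniteMeasure_weightMeasure [NeZero d] {ν : ℝ} (hν : -1 < ν) :
    IsFiniteMeasure (weightMeasure d ν) := by
  rw [weightMeasure_eq]
  exact isFiniteMeasure_withDensity_ofReal (integrableOn_weight hν).2

theorem ballMeasure_eq (ν : ℝ) : ballMeasure d ν =
    (weightMeasure d ν Set.univ)⁻¹ • weightMeasure d ν := by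
  rw [ballMeasure]
  congr 2
  rw [weightMeasure, withDensity_apply _ MeasurableSet.univ, Measure.restrict_univ]

theorem weightMeasure_univ_ne_zero (ν : ℝ) : weightMeasure d ν Set.univ ≠ 0 := by
  intro h
  have h₁ := absolutelyContinuous_weightMeasure (d := d) ν h
  rw [Measure.restrict_apply_univ] at h₁
  exact (Metric.measure_ball_pos volume (0 : Space d) one_pos).ne' h₁

/-- The inverse of the total mass of the weighted measure. -/
def normConst (d : ℕ) (ν : ℝ) : ℝ≥0∞ := (weightMeasure d ν Set.univ)⁻¹

theorem normConst_ne_zero [NeZero d] {ν : ℝ} (hν : -1 < ν) : normConst d ν ≠ 0 := by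
  have := isFiniteMeasure_weightMeasure (d := d) hν
  exact ENNReal.inv_ne_zero.2 (measure_ne_top _ _)

theorem normConst_ne_top (ν : ℝ) : normConst d ν ≠ ∞ :=
  ENNReal.inv_ne_top.2 (weightMeasure_univ_ne_zero ν)

theorem memLp_ballMeasure_iff [NeZero d] {ν : ℝ} (hν : -1 < ν) (g : Space d → ℝ) :
    MemLp g 2 (ballMeasure d ν) ↔ MemLp g 2 (weightMeasure d ν) := by
  rw [ballMeasure_eq]
  rw [← normConst]
  refine ⟨fun h => ?_, fun h => h.smul_measure (normConst_ne_top ν)⟩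
  have := h.smul_measure (ENNReal.inv_ne_top.2 (normConst_ne_zero (d := d) hν))
  rwa [smul_smul, ENNReal.inv_mul_cancel (normConst_ne_zero hν) (normConst_ne_top ν),
    one_smul] at this

theorem ballNorm_eq [NeZero d] {ν : ℝ} (hν : -1 < ν) (g : Space d → ℝ) :
    ballNorm ν g = normConst d ν ^ (1 / 2 : ℝ) * eLpNorm g 2 (weightMeasure d ν) := by
  rw [ballNorm, ballMeasure_eq, ← normConst, eLpNorm_smul_measure_of_ne_zero (normConst_ne_zero hν)]
  simp

end Measures

/-! ### Polynomials as functions on the ball -/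

section PolyFun

variable {d : ℕ}

/-- The function defined by a polynomial. -/
def polyFun : Poly d →ₐ[ℝ] (Space d → ℝ) where
  toFun p x := eval (fun i => x i) p
  map_one' := by ext; simp
  map_mul' _ _ := by ext; simp
  map_zero' := by ext; simp
  map_add' _ _ := by ext; simp
  commutes' r := by ext; simp

theorem polyFun_apply (p : Poly d) (x : Space d) : polyFun p x = eval (fun i => x i) p := rfl

theorem continuous_polyFun (p : Poly d) : Continuous (polyFun p) :=
  (MvPolynomial.continuous_eval p).comp (by fun_prop)

theorem polyFun_normSqPoly (x : Space d) : polyFun (normSqPoly d) x = ‖x‖ ^ 2 := by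
  simp [polyFun_apply, normSqPoly, EuclideanSpace.norm_sq_eq]

theorem contDiff_polyFun {n : WithTop ℕ∞} (p : Poly d) : ContDiff ℝ n (polyFun p) := by
  induction p using MvPolynomial.induction_on with
  | C a =>
    have : polyFun (C a : Poly d) = fun _ => a := by ext; simp [polyFun_apply]
    rw [this]
    exact contDiff_const
  | add p q hp hq => rw [map_add]; exact hp.add hq
  | mul_X p i hp =>
    rw [map_mul]
    refine hp.mul ?_
    have : polyFun (X i) = fun x : Space d => x i := by ext; simp [polyFun_apply]
    rw [this]
    fun_prop

theorem classicalPartial_polyFun (i : Fin d) (p : Poly d) :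
    classicalPartial i (polyFun p) = polyFun (pderiv i p) := by
  induction p using MvPolynomial.induction_on with
  | C a =>
    ext x
    have : polyFun (C a : Poly d) = fun _ => a := by ext; simp [polyFun_apply]
    simp [classicalPartial, this]
  | add p q hp hq =>
    ext x
    have hp' := congrFun hp x
    have hq' := congrFun hq x
    simp only [classicalPartial, map_add] at *
    rw [fderiv_add ((contDiff_polyFun (n := 1) p).differentiable (by simp) x)
      ((contDiff_polyFun (n := 1) q).differentiable (by simp) x)]
    simp [hp', hq']
  | mul_X p j hp =>
    ext x
    have hp' := congrFun hp x
    have hX : polyFun (X j) = fun x : Space d => x j := by ext; simp [polyFun_apply]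
    have hd : HasFDerivAt (fun x : Space d => x j) (EuclideanSpace.proj j : Space d →L[ℝ] ℝ) x :=
      (EuclideanSpace.proj j : Space d →L[ℝ] ℝ).hasFDerivAt
    simp only [classicalPartial] at *
    rw [map_mul, hX, fderiv_mul ((contDiff_polyFun (n := 1) p).differentiable (by simp) x)
      hd.differentiableAt, hd.fderiv, Derivation.leibniz, pderiv_X_eq]
    rcases eq_or_ne i j with rfl | h
    · simp [hp', polyFun_apply, mul_comm]
    · simp [hp', polyFun_apply, h, h.symm, mul_comm]

theorem exists_polyFun_bound (p : Poly d) :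
    ∃ C, ∀ x ∈ Metric.ball (0 : Space d) 1, ‖polyFun p x‖ ≤ C := by
  obtain ⟨C, hC⟩ := (isCompact_closedBall (0 : Space d) 1).exists_bound_of_continuousOn
    (continuous_polyFun p).continuousOn
  exact ⟨C, fun x hx => hC x (Metric.ball_subset_closedBall hx)⟩

theorem memLp_polyFun [NeZero d] {ν : ℝ} (hν : -1 < ν) (p : Poly d) :
    MemLp (polyFun p) 2 (weightMeasure d ν) := by
  have := isFiniteMeasure_weightMeasure (d := d) hν
  obtain ⟨C, hC⟩ := exists_polyFun_bound p
  refine MemLp.of_bound (continuous_polyFun p).aestronglyMeasurable C ?_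
  filter_upwards [ae_mem_ball ν] with x hx using hC x hx

theorem memLp_mul_polyFun {ν : ℝ} {g : Space d → ℝ} (hg : MemLp g 2 (weightMeasure d ν))
    (p : Poly d) : MemLp (fun x => polyFun p x * g x) 2 (weightMeasure d ν) := by
  obtain ⟨C, hC⟩ := exists_polyFun_bound p
  refine hg.of_le_mul (c := C)
    ((continuous_polyFun p).aestronglyMeasurable.mul hg.aestronglyMeasurable) ?_
  filter_upwards [ae_mem_ball ν] with x hx
  rw [norm_mul]
  exact mul_le_mul_of_nonneg_right (hC x hx) (norm_nonneg _)

theorem integrable_mul_polyFun [NeZero d] {ν : ℝ} (hν : -1 < ν) {g : Space d → ℝ}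
    (hg : MemLp g 2 (weightMeasure d ν)) (p : Poly d) :
    Integrable (fun x => g x * polyFun p x) (weightMeasure d ν) :=
  hg.integrable_mul (memLp_polyFun hν p)

/-- Definiteness of the inner product. Continuity upgrades almost-everywhere vanishing to vanishing
on the open ball, which contains a cube; a polynomial zero on a product of infinite sets is zero. -/
theorem eq_zero_of_integral_sq_eq_zero [NeZero d] {ν : ℝ} (hν : -1 < ν) {p : Poly d}
    (h : ∫ x, polyFun p x * polyFun p x ∂weightMeasure d ν = 0) : p = 0 := by
  have h₁ := (integral_eq_zero_iff_of_nonneg (fun x => mul_self_nonneg (polyFun p x))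
    (integrable_mul_polyFun hν (memLp_polyFun hν p) p)).1 h
  have h₂ := (absolutelyContinuous_weightMeasure ν).ae_le h₁
  have h₃ : Set.EqOn (fun x => polyFun p x * polyFun p x) 0 (Metric.ball (0 : Space d) 1) := by
    refine MeasureTheory.Measure.eqOn_open_of_ae_eq h₂ Metric.isOpen_ball ?_ ?_
    · exact ((continuous_polyFun p).mul (continuous_polyFun p)).continuousOn
    · exact continuousOn_const
  have hb : ∃ ε > 0, ∀ y : Fin d → ℝ, (∀ i, y i ∈ Set.Ioo (-ε) ε) →
      WithLp.toLp 2 y ∈ Metric.ball (0 : Space d) 1 := by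
    have ho : IsOpen ((fun y : Fin d → ℝ => (WithLp.toLp 2 y : Space d)) ⁻¹'
        Metric.ball (0 : Space d) 1) :=
      Metric.isOpen_ball.preimage (PiLp.continuous_toLp 2 _)
    obtain ⟨ε, hε, h⟩ := Metric.isOpen_iff.1 ho 0 (by simp)
    refine ⟨ε, hε, fun y hy => h ?_⟩
    rw [mem_ball_zero_iff, pi_norm_lt_iff hε]
    exact fun i => abs_lt.2 (hy i)
  obtain ⟨ε, hε, hb⟩ := hb
  refine funext_set (fun _ => Set.Ioo (-ε) ε) (fun _ => Set.Ioo_infinite (by linarith))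
    fun y hy => ?_
  have := h₃ (hb y fun i => hy i trivial)
  simpa [polyFun_apply] using this

/-- The Stone–Weierstrass theorem; the coordinates separate points. -/
theorem exists_polyFun_near {g : Space d → ℝ} (hg : Continuous g) {ε : ℝ} (hε : 0 < ε) :
    ∃ p : Poly d, ∀ x ∈ Metric.closedBall (0 : Space d) 1, ‖polyFun p x - g x‖ < ε := by
  let φ : Poly d →ₐ[ℝ] C(Space d, ℝ) :=
    MvPolynomial.aeval fun i => (⟨fun x => x i, by fun_prop⟩ : C(Space d, ℝ))
  have hφ : ∀ p x, φ p x = polyFun p x := fun p x => by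
    have : (ContinuousMap.evalAlgHom ℝ ℝ x).comp φ =
        (Pi.evalAlgHom ℝ (fun _ : Space d => ℝ) x).comp polyFun := by
      ext i; simp [φ, polyFun_apply]
    exact DFunLike.congr_fun this p
  have hsep : φ.range.SeparatesPoints := by
    intro x y hxy
    obtain ⟨i, hi⟩ : ∃ i, x i ≠ y i := by
      by_contra! h
      exact hxy (PiLp.ext h)
    refine ⟨_, ⟨φ (X i), ⟨X i, rfl⟩, rfl⟩, ?_⟩
    simpa [hφ, polyFun_apply] using hi
  obtain ⟨q, ⟨p, rfl⟩, hq⟩ :=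
    ContinuousMap.exists_mem_subalgebra_near_continuous_of_isCompact_of_separatesPoints hsep
      ⟨g, hg⟩ (isCompact_closedBall (0 : Space d) 1) hε
  exact ⟨p, fun x hx => by simpa [hφ] using hq x hx⟩

theorem exists_eLpNorm_sub_polyFun_le [NeZero d] {ν : ℝ} (hν : -1 < ν) {f : Space d → ℝ}
    (hf : MemLp f 2 (weightMeasure d ν)) {ε : ℝ} (hε : 0 < ε) :
    ∃ p : Poly d, eLpNorm (f - polyFun p) 2 (weightMeasure d ν) ≤ ENNReal.ofReal ε := by
  have := isFiniteMeasure_weightMeasure (d := d) hν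
  have : (weightMeasure d ν).Regular := inferInstance
  obtain ⟨g, -, hfg, hgc, hgm⟩ := hf.exists_hasCompactSupport_eLpNorm_sub_le (by simp)
    (ε := ENNReal.ofReal (ε / 2)) (by simpa using hε)
  set K : ℝ := ((weightMeasure d ν Set.univ) ^ (1 / 2 : ℝ)).toReal with hK
  have hKtop : (weightMeasure d ν Set.univ) ^ (1 / 2 : ℝ) ≠ ∞ :=
    ENNReal.rpow_ne_top_of_nonneg (by norm_num) (measure_ne_top _ _)
  have hK0 : 0 ≤ K := ENNReal.toReal_nonneg
  obtain ⟨p, hp⟩ := exists_polyFun_near hgc (ε := ε / 2 / (K + 1)) (by positivity)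
  refine ⟨p, ?_⟩
  have h₂ : eLpNorm (g - polyFun p) 2 (weightMeasure d ν) ≤ ENNReal.ofReal (ε / 2) := by
    have h := eLpNorm_le_of_ae_bound (p := 2) (μ := weightMeasure d ν) (f := g - polyFun p)
      (C := ε / 2 / (K + 1)) (by
        filter_upwards [ae_mem_ball ν] with x hx
        have := hp x (Metric.ball_subset_closedBall hx)
        rw [norm_sub_rev] at this
        exact this.le)
    refine h.trans ?_
    rw [show ((2 : ℝ≥0∞).toReal)⁻¹ = (1 / 2 : ℝ) by simp, ← ENNReal.ofReal_toReal hKtop,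
      ← ENNReal.ofReal_mul hK0]
    refine ENNReal.ofReal_le_ofReal ?_
    rw [mul_div_assoc', div_le_iff₀ (by positivity)]
    nlinarith
  calc eLpNorm (f - polyFun p) 2 (weightMeasure d ν)
      = eLpNorm ((f - g) + (g - polyFun p)) 2 (weightMeasure d ν) := by congr 1; abel
    _ ≤ _ := eLpNorm_add_le (hf.sub hgm).aestronglyMeasurable
        (hgm.sub (memLp_polyFun hν p)).aestronglyMeasurable (by norm_num)
    _ ≤ ENNReal.ofReal (ε / 2) + ENNReal.ofReal (ε / 2) := add_le_add hfg h₂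
    _ = ENNReal.ofReal ε := by
      rw [← ENNReal.ofReal_add (by positivity) (by positivity), add_halves]

end PolyFun

/-! ### Test functions and classical derivatives -/

section TestFunctions

variable {d : ℕ}

/-- Smooth functions with compact support in the open unit ball. -/
structure IsTest (φ : Space d → ℝ) : Prop where
  contDiff : ContDiff ℝ ((⊤ : ℕ∞) : WithTop ℕ∞) φ
  hasCompactSupport : HasCompactSupport φ
  tsupport_subset : tsupport φ ⊆ Metric.ball 0 1

/-- The bundled test function. -/
def IsTest.toTestFunction {φ : Space d → ℝ} (h : IsTest φ) : 𝓓(openBall d, ℝ) :=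
  ⟨φ, h.contDiff, h.hasCompactSupport, h.tsupport_subset⟩

theorem IsTest.coe_toTestFunction {φ : Space d → ℝ} (h : IsTest φ) :
    (h.toTestFunction : Space d → ℝ) = φ := rfl

theorem isTest_coe (φ : 𝓓(openBall d, ℝ)) : IsTest (φ : Space d → ℝ) :=
  ⟨φ.contDiff, φ.hasCompactSupport, φ.tsupport_subset⟩

theorem contDiff_classicalPartial (i : Fin d) {φ : Space d → ℝ}
    (h : ContDiff ℝ ((⊤ : ℕ∞) : WithTop ℕ∞) φ) :
    ContDiff ℝ ((⊤ : ℕ∞) : WithTop ℕ∞) (classicalPartial i φ) :=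
  (h.fderiv_right (m := ((⊤ : ℕ∞) : WithTop ℕ∞)) (by simp)).clm_apply contDiff_const

theorem tsupport_classicalPartial_subset (i : Fin d) (φ : Space d → ℝ) :
    tsupport (classicalPartial i φ) ⊆ tsupport φ := by
  refine closure_minimal (fun x hx => ?_) (isClosed_tsupport φ)
  by_contra hc
  have h0 : φ =ᶠ[nhds x] 0 := notMem_tsupport_iff_eventuallyEq.1 hc
  refine hx ?_
  simp [classicalPartial, h0.fderiv_eq]

theorem IsTest.classicalPartial (i : Fin d) {φ : Space d → ℝ} (h : IsTest φ) :
    IsTest (classicalPartial i φ) where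
  contDiff := contDiff_classicalPartial i h.contDiff
  hasCompactSupport := h.hasCompactSupport.of_isClosed_subset (isClosed_tsupport _)
    (tsupport_classicalPartial_subset i φ)
  tsupport_subset := (tsupport_classicalPartial_subset i φ).trans h.tsupport_subset

theorem classicalPartial_comm (i j : Fin d) {φ : Space d → ℝ}
    (h : ContDiff ℝ ((⊤ : ℕ∞) : WithTop ℕ∞) φ) :
    classicalPartial i (classicalPartial j φ) = classicalPartial j (classicalPartial i φ) := by
  have hd : Differentiable ℝ (fderiv ℝ φ) :=
    (h.fderiv_right (m := ((⊤ : ℕ∞) : WithTop ℕ∞)) (by simp)).differentiable (by simp)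
  have key : ∀ i j : Fin d, ∀ x, classicalPartial i (classicalPartial j φ) x =
      fderiv ℝ (fderiv ℝ φ) x (EuclideanSpace.single i 1) (EuclideanSpace.single j 1) :=
      fun i j x => by
    unfold classicalPartial
    rw [fderiv_clm_apply (hd x) (differentiableAt_const _)]
    simp
  ext x
  rw [key, key]
  exact (h.contDiffAt.isSymmSndFDerivAt 
    (by simpa using WithTop.coe_le_coe.2 (le_top : (2 : ℕ∞) ≤ ⊤))) _ _

theorem contDiff_classicalPartial_iterate (i : Fin d) (k : ℕ) {φ : Space d → ℝ}
    (h : ContDiff ℝ ((⊤ : ℕ∞) : WithTop ℕ∞) φ) :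
    ContDiff ℝ ((⊤ : ℕ∞) : WithTop ℕ∞) ((classicalPartial i)^[k] φ) := by
  induction k with
  | zero => exact h
  | succ k ih =>
    rw [Function.iterate_succ_apply']
    exact contDiff_classicalPartial i ih

theorem classicalPartial_iterate_comm (i j : Fin d) (k : ℕ) {φ : Space d → ℝ}
    (h : ContDiff ℝ ((⊤ : ℕ∞) : WithTop ℕ∞) φ) :
    classicalPartial i ((classicalPartial j)^[k] φ) =
      (classicalPartial j)^[k] (classicalPartial i φ) := by
  induction k with
  | zero => rfl
  | succ k ih =>
    rw [Function.iterate_succ_apply', Function.iterate_succ_apply', ← ih,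
      classicalPartial_comm i j (contDiff_classicalPartial_iterate j k h)]

theorem contDiff_foldr_classicalPartial (l : List (Fin d)) (m : Fin d → ℕ) {φ : Space d → ℝ}
    (h : ContDiff ℝ ((⊤ : ℕ∞) : WithTop ℕ∞) φ) :
    ContDiff ℝ ((⊤ : ℕ∞) : WithTop ℕ∞)
      (l.foldr (fun i ψ => (classicalPartial i)^[m i] ψ) φ) := by
  induction l with
  | nil => exact h
  | cons j l ih => exact contDiff_classicalPartial_iterate j _ ih

/-- The extra `∂ᵢ` commutes past the earlier derivatives until it reaches the block of index `i`,
which occurs once. -/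
theorem classicalPartial_foldr (i : Fin d) (l : List (Fin d)) (hl : l.Nodup) (hi : i ∈ l)
    (m : Fin d → ℕ) {φ : Space d → ℝ} (h : ContDiff ℝ ((⊤ : ℕ∞) : WithTop ℕ∞) φ) :
    classicalPartial i (l.foldr (fun i ψ => (classicalPartial i)^[m i] ψ) φ) =
      l.foldr (fun j ψ => (classicalPartial j)^[(m + Pi.single i 1 : Fin d → ℕ) j] ψ) φ := by
  induction l with
  | nil => simp at hi
  | cons j l ih =>
    rw [List.nodup_cons] at hl
    simp only [List.foldr_cons]
    rcases eq_or_ne i j with rfl | hij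
    · have : l.foldr (fun j ψ => (classicalPartial j)^[(m + Pi.single i 1 : Fin d → ℕ) j] ψ) φ =
          l.foldr (fun j ψ => (classicalPartial j)^[m j] ψ) φ := by
        refine List.foldr_ext _ _ _ fun k hk ψ => ?_
        have : k ≠ i := fun hki => hl.1 (hki ▸ hk)
        simp [this]
      rw [this]
      simp only [Pi.add_apply, Pi.single_eq_same, Function.iterate_succ_apply']
    · rw [← ih hl.2 ((List.mem_cons.1 hi).resolve_left hij),
        classicalPartial_iterate_comm i j _ (contDiff_foldr_classicalPartial l m h)]
      simp [hij.symm]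

theorem classicalPartial_classicalDeriv (i : Fin d) (m : Fin d → ℕ) {φ : Space d → ℝ}
    (h : ContDiff ℝ ((⊤ : ℕ∞) : WithTop ℕ∞) φ) :
    classicalPartial i (classicalDeriv m φ) = classicalDeriv (m + Pi.single i 1) φ :=
  classicalPartial_foldr i _ (List.nodup_finRange d) (List.mem_finRange i) m h

theorem classicalDeriv_zero (φ : Space d → ℝ) : classicalDeriv 0 φ = φ := by
  have : ∀ l : List (Fin d), l.foldr (fun i ψ => (classicalPartial i)^[(0 : Fin d → ℕ) i] ψ) φ = φ :=
    fun l => by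
    induction l with
    | nil => rfl
    | cons j l ih => exact ih
  exact this _

theorem classicalDeriv_single_one (i : Fin d) {φ : Space d → ℝ}
    (h : ContDiff ℝ ((⊤ : ℕ∞) : WithTop ℕ∞) φ) :
    classicalDeriv (Pi.single i 1) φ = classicalPartial i φ := by
  rw [← zero_add (Pi.single i 1), ← classicalPartial_classicalDeriv i 0 h, classicalDeriv_zero]

theorem classicalDeriv_single_two (i : Fin d) {φ : Space d → ℝ}
    (h : ContDiff ℝ ((⊤ : ℕ∞) : WithTop ℕ∞) φ) :
    classicalDeriv (Pi.single i 2) φ = classicalPartial i (classicalPartial i φ) := by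
  rw [← classicalDeriv_single_one i h, classicalPartial_classicalDeriv i _ h, ← Pi.single_add]

theorem IsTest.iterate (i : Fin d) (k : ℕ) {φ : Space d → ℝ} (h : IsTest φ) :
    IsTest ((BallApprox.classicalPartial i)^[k] φ) := by
  induction k with
  | zero => exact h
  | succ k ih =>
    rw [Function.iterate_succ_apply']
    exact ih.classicalPartial i

theorem IsTest.classicalDeriv (m : Fin d → ℕ) {φ : Space d → ℝ} (h : IsTest φ) :
    IsTest (classicalDeriv m φ) := by
  have : ∀ l : List (Fin d),
      IsTest (l.foldr (fun i ψ => (BallApprox.classicalPartial i)^[m i] ψ) φ) := fun l => by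
    induction l with
    | nil => exact h
    | cons j l ih => exact ih.iterate j _
  exact this _

theorem integrableOn_mul_of_isTest {g φ : Space d → ℝ}
    (hg : LocallyIntegrableOn g (Metric.ball 0 1) volume) (hφ : IsTest φ) :
    IntegrableOn (fun x => g x * φ x) (Metric.ball 0 1) := by
  have hK := hg.integrableOn_compact_subset hφ.tsupport_subset hφ.hasCompactSupport
  have h₁ : IntegrableOn (fun x => g x * φ x) (tsupport φ) :=
    hK.mul_continuousOn hφ.contDiff.continuous.continuousOn hφ.hasCompactSupport
  have h₂ : Integrable (fun x => g x * φ x) := by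
    refine (integrableOn_iff_integrable_of_support_subset fun x hx => ?_).1 h₁
    exact subset_tsupport _ (right_ne_zero_of_mul hx)
  exact h₂.integrableOn

theorem IsTest.polyFun_mul (p : Poly d) {φ : Space d → ℝ} (h : IsTest φ) :
    IsTest (fun x => polyFun p x * φ x) where
  contDiff := (contDiff_polyFun p).mul h.contDiff
  hasCompactSupport := h.hasCompactSupport.mul_left
  tsupport_subset := (tsupport_mul_subset_right (f := polyFun p)).trans h.tsupport_subset

theorem classicalPartial_polyFun_mul (i : Fin d) (p : Poly d) {φ : Space d → ℝ} (h : IsTest φ)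
    (x : Space d) : classicalPartial i (fun x => polyFun p x * φ x) x =
      polyFun p x * classicalPartial i φ x + polyFun (pderiv i p) x * φ x := by
  have h₁ := congrFun (classicalPartial_polyFun i p) x
  simp only [classicalPartial] at *
  rw [fderiv_fun_mul ((contDiff_polyFun (n := 1) p).differentiable (by simp) x)
    (h.contDiff.differentiable (by simp) x)]
  simp [← h₁, mul_comm]

end TestFunctions

/-! ### Weak first order derivatives -/

section WeakPartial

variable {d : ℕ}

/-- `g` is the weak derivative `∂ᵢ f` in the open unit ball. -/
structure WeakPartial (i : Fin d) (f g : Space d → ℝ) : Prop where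
  left : LocallyIntegrableOn f (Metric.ball 0 1) volume
  right : LocallyIntegrableOn g (Metric.ball 0 1) volume
  integral_eq : ∀ φ : Space d → ℝ, IsTest φ →
    ∫ x in Metric.ball (0 : Space d) 1, f x * classicalPartial i φ x =
      -∫ x in Metric.ball (0 : Space d) 1, g x * φ x

theorem ae_eq_of_forall_isTest {g g' : Space d → ℝ}
    (hg : LocallyIntegrableOn g (Metric.ball 0 1) volume)
    (hg' : LocallyIntegrableOn g' (Metric.ball 0 1) volume)
    (h : ∀ φ : Space d → ℝ, IsTest φ → ∫ x in Metric.ball (0 : Space d) 1, g x * φ x =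
      ∫ x in Metric.ball (0 : Space d) 1, g' x * φ x) :
    g =ᵐ[volume.restrict (Metric.ball 0 1)] g' := by
  have h₁ := Metric.isOpen_ball.ae_eq_zero_of_integral_contDiff_smul_eq_zero (hg.sub hg')
    fun φ h₁ h₂ h₃ => by
      have hφ : IsTest φ := ⟨h₁, h₂, h₃⟩
      have h₄ : ∫ x in Metric.ball (0 : Space d) 1, (g x * φ x - g' x * φ x) = 0 := by
        rw [integral_sub (integrableOn_mul_of_isTest hg hφ) (integrableOn_mul_of_isTest hg' hφ),
          h φ hφ, sub_self]
      rw [← h₄, ← setIntegral_eq_integral_of_forall_compl_eq_zero (s := Metric.ball 0 1)]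
      · refine setIntegral_congr_fun measurableSet_ball fun x _ => ?_
        simp only [Pi.sub_apply, smul_eq_mul]
        ring
      · intro x hx
        have : φ x = 0 := image_eq_zero_of_notMem_tsupport fun hc => hx (h₃ hc)
        simp [this]
  refine (ae_restrict_iff' measurableSet_ball).2 (h₁.mono fun x hx hxb => ?_)
  simpa [sub_eq_zero] using hx hxb

/-- Uniqueness of weak derivatives: it permits replacing the arbitrary choice in `weakDeriv` by any
convenient representative. -/
theorem HasWeakDeriv.ae_eq {m : Fin d → ℕ} {f f' g g' : Space d → ℝ} (h : HasWeakDeriv m f g)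
    (h' : HasWeakDeriv m f' g') (hf : f =ᵐ[volume.restrict (Metric.ball 0 1)] f') :
    g =ᵐ[volume.restrict (Metric.ball 0 1)] g' := by
  refine ae_eq_of_forall_isTest h.2.1 h'.2.1 fun φ hφ => ?_
  have h₁ := h.2.2 hφ.toTestFunction
  have h₂ := h'.2.2 hφ.toTestFunction
  have h₃ : ∫ x in Metric.ball (0 : Space d) 1, f x * classicalDeriv m hφ.toTestFunction x =
      ∫ x in Metric.ball (0 : Space d) 1, f' x * classicalDeriv m hφ.toTestFunction x :=
    integral_congr_ae (hf.mono fun x hx => by simp only [hx])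
  rw [h₁, h₂] at h₃
  exact mul_left_cancel₀ (pow_ne_zero _ (by norm_num)) h₃

theorem HasWeakDeriv.weakDeriv_ae_eq {m : Fin d → ℕ} {f g : Space d → ℝ}
    (h : HasWeakDeriv m f g) :
    weakDeriv m f =ᵐ[volume.restrict (Metric.ball 0 1)] g := by
  have hex : ∃ g, HasWeakDeriv m f g := ⟨g, h⟩
  rw [weakDeriv, dif_pos hex]
  exact hex.choose_spec.ae_eq h Filter.EventuallyEq.rfl

theorem hasWeakDeriv_single_one_iff {i : Fin d} {f g : Space d → ℝ} :
    HasWeakDeriv (Pi.single i 1) f g ↔ WeakPartial i f g := by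
  constructor
  · intro h
    refine ⟨h.1, h.2.1, fun φ hφ => ?_⟩
    have := h.2.2 hφ.toTestFunction
    rw [IsTest.coe_toTestFunction, classicalDeriv_single_one i hφ.contDiff] at this
    simpa using this
  · intro h
    refine ⟨h.1, h.2, fun φ => ?_⟩
    have := h.integral_eq φ (isTest_coe φ)
    rw [classicalDeriv_single_one i (isTest_coe φ).contDiff, this]
    simp

theorem WeakPartial.hasWeakDeriv_single_two {i : Fin d} {f g h : Space d → ℝ}
    (hfg : WeakPartial i f g) (hgh : WeakPartial i g h) : HasWeakDeriv (Pi.single i 2) f h := by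
  refine ⟨hfg.1, hgh.2, fun φ => ?_⟩
  have hφ := isTest_coe φ
  rw [classicalDeriv_single_two i hφ.contDiff, hfg.integral_eq _ (hφ.classicalPartial i),
    hgh.integral_eq _ hφ]
  simp

theorem WeakPartial.congr {i : Fin d} {f f' g g' : Space d → ℝ} (h : WeakPartial i f g)
    (hf : f =ᵐ[volume.restrict (Metric.ball 0 1)] f')
    (hg : g =ᵐ[volume.restrict (Metric.ball 0 1)] g') : WeakPartial i f' g' := by
  refine ⟨h.1.congr hf, h.2.congr hg, fun φ hφ => ?_⟩
  rw [integral_congr_ae (g := fun x => f x * classicalPartial i φ x)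
      (hf.mono fun x hx => by simp only [hx]), h.integral_eq φ hφ,
    integral_congr_ae (g := fun x => g' x * φ x) (hg.mono fun x hx => by simp only [hx])]

theorem WeakPartial.add {i : Fin d} {f f' g g' : Space d → ℝ} (h : WeakPartial i f g)
    (h' : WeakPartial i f' g') : WeakPartial i (f + f') (g + g') := by
  refine ⟨h.1.add h'.1, h.2.add h'.2, fun φ hφ => ?_⟩
  simp only [Pi.add_apply, add_mul]
  rw [integral_add (integrableOn_mul_of_isTest h.1 (hφ.classicalPartial i))
    (integrableOn_mul_of_isTest h'.1 (hφ.classicalPartial i)),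
    integral_add (integrableOn_mul_of_isTest h.2 hφ) (integrableOn_mul_of_isTest h'.2 hφ),
    h.integral_eq φ hφ, h'.integral_eq φ hφ]
  ring

theorem locallyIntegrableOn_polyFun_mul (p : Poly d) {g : Space d → ℝ}
    (hg : LocallyIntegrableOn g (Metric.ball 0 1) volume) :
    LocallyIntegrableOn (fun x => polyFun p x * g x) (Metric.ball 0 1) volume :=
  hg.continuousOn_mul (continuous_polyFun p).continuousOn Metric.isOpen_ball.isLocallyClosed

/-- The product rule follows by testing with `p φ` in place of `φ`. -/
theorem WeakPartial.polyFun_mul {i : Fin d} {f g : Space d → ℝ} (h : WeakPartial i f g)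
    (p : Poly d) : WeakPartial i (fun x => polyFun p x * f x)
      (fun x => polyFun p x * g x + polyFun (pderiv i p) x * f x) := by
  have h₂ := (locallyIntegrableOn_polyFun_mul p h.2).add
    (locallyIntegrableOn_polyFun_mul (pderiv i p) h.1)
  refine ⟨locallyIntegrableOn_polyFun_mul p h.1, h₂, fun φ hφ => ?_⟩
  have h₁ := h.integral_eq _ (hφ.polyFun_mul p)
  have e₁ : ∀ x, f x * classicalPartial i (fun x => polyFun p x * φ x) x =
      polyFun p x * f x * classicalPartial i φ x + polyFun (pderiv i p) x * f x * φ x :=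
      fun x => by
    rw [classicalPartial_polyFun_mul i p hφ]; ring
  simp only [e₁] at h₁
  rw [integral_add
    (integrableOn_mul_of_isTest (locallyIntegrableOn_polyFun_mul p h.1) (hφ.classicalPartial i))
    (integrableOn_mul_of_isTest (locallyIntegrableOn_polyFun_mul (pderiv i p) h.1) hφ)] at h₁
  simp only [add_mul]
  rw [integral_add (integrableOn_mul_of_isTest (locallyIntegrableOn_polyFun_mul p h.2) hφ)
    (integrableOn_mul_of_isTest (locallyIntegrableOn_polyFun_mul (pderiv i p) h.1) hφ)]
  have e₂ : ∀ x, g x * (polyFun p x * φ x) = polyFun p x * g x * φ x := fun x => by ring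
  simp only [e₂] at h₁
  linarith

theorem weakPartial_polyFun (i : Fin d) (p : Poly d) :
    WeakPartial i (polyFun p) (polyFun (pderiv i p)) := by
  have hl : ∀ p : Poly d, LocallyIntegrableOn (polyFun p) (Metric.ball 0 1) volume := fun p =>
    (continuous_polyFun p).locallyIntegrable.locallyIntegrableOn _
  refine ⟨hl _, hl _, fun φ hφ => ?_⟩
  have hc : ∀ {ψ : Space d → ℝ}, IsTest ψ → ∀ p : Poly d,
      Integrable (fun x => polyFun p x * ψ x) := fun hψ p =>
    ((continuous_polyFun p).mul hψ.contDiff.continuous).integrable_of_hasCompactSupport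
      hψ.hasCompactSupport.mul_left
  have hs : ∀ {ψ : Space d → ℝ}, IsTest ψ → ∀ p : Poly d,
      ∫ x in Metric.ball (0 : Space d) 1, polyFun p x * ψ x = ∫ x, polyFun p x * ψ x :=
      fun hψ p => by
    refine setIntegral_eq_integral_of_forall_compl_eq_zero fun x hx => ?_
    rw [image_eq_zero_of_notMem_tsupport fun hc => hx (hψ.tsupport_subset hc), mul_zero]
  rw [hs (hφ.classicalPartial i) p, hs hφ]
  have e := classicalPartial_polyFun i p
  have h₁ := integral_mul_fderiv_eq_neg_fderiv_mul_of_integrable (μ := volume)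
    (f := polyFun p) (g := φ) (v := EuclideanSpace.single i (1 : ℝ))
    (by
      have := hc hφ (pderiv i p)
      rwa [← e] at this)
    (hc (hφ.classicalPartial i) p) (hc hφ p)
    (fun x _ => (contDiff_polyFun (n := 1) p).differentiable (by simp) x)
    (fun x _ => hφ.contDiff.differentiable (by simp) x)
  rw [← e]
  exact h₁

end WeakPartial

/-! ### Radial cutoffs -/

section Radial

variable {d : ℕ}

/-- Smooth functions on the line vanishing on a neighbourhood of `[1, ∞)`. -/
structure IsRadialCutoff (ψ : ℝ → ℝ) : Prop where
  contDiff : ContDiff ℝ ((⊤ : ℕ∞) : WithTop ℕ∞) ψ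
  exists_eq_zero : ∃ ε > 0, ∀ t, 1 - ε ≤ t → ψ t = 0

theorem IsRadialCutoff.isTest {ψ : ℝ → ℝ} (h : IsRadialCutoff ψ) (p : Poly d) :
    IsTest (fun x : Space d => polyFun p x * ψ (‖x‖ ^ 2)) := by
  obtain ⟨ε, hε, hψ⟩ := h.exists_eq_zero
  have hs : tsupport (fun x : Space d => polyFun p x * ψ (‖x‖ ^ 2)) ⊆
      {x | ‖x‖ ^ 2 ≤ 1 - ε} := by
    refine closure_minimal (fun x hx => ?_) (isClosed_le (by fun_prop) continuous_const)
    by_contra hc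
    simp only [Set.mem_ofPred_eq, not_le] at hc
    exact hx (by simp [hψ _ hc.le])
  have hb : {x : Space d | ‖x‖ ^ 2 ≤ 1 - ε} ⊆ Metric.ball 0 1 := fun x hx => by
    simp only [Set.mem_ofPred_eq] at hx
    rw [mem_ball_zero_iff]
    nlinarith [norm_nonneg x]
  refine ⟨(contDiff_polyFun p).mul (h.contDiff.comp (contDiff_norm_sq ℝ)), ?_, hs.trans hb⟩
  exact (isCompact_closedBall (0 : Space d) 1).of_isClosed_subset (isClosed_tsupport _)
    ((hs.trans hb).trans Metric.ball_subset_closedBall)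

/-- The derivative falling on the radial factor comes with `xᵢ`. This shape makes it cancel in
angular derivatives. -/
theorem IsRadialCutoff.classicalPartial_eq {ψ : ℝ → ℝ} (h : IsRadialCutoff ψ) (p : Poly d)
    (i : Fin d) (x : Space d) :
    classicalPartial i (fun x : Space d => polyFun p x * ψ (‖x‖ ^ 2)) x =
      polyFun (pderiv i p) x * ψ (‖x‖ ^ 2) +
        2 * polyFun (X i * p) x * deriv ψ (‖x‖ ^ 2) := by
  have h₁ := congrFun (classicalPartial_polyFun i p) x
  have h₂ : HasFDerivAt (fun x : Space d => ψ (‖x‖ ^ 2))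
      (deriv ψ (‖x‖ ^ 2) • (2 • innerSL ℝ x)) x :=
    ((h.contDiff.differentiable (by simp) (‖x‖ ^ 2)).hasDerivAt.comp_hasFDerivAt x
      (hasStrictFDerivAt_norm_sq x).hasFDerivAt)
  simp only [classicalPartial] at *
  rw [fderiv_fun_mul ((contDiff_polyFun (n := 1) p).differentiable (by simp) x)
    h₂.differentiableAt, h₂.fderiv]
  simp only [add_apply, smul_apply, h₁, smul_eq_mul,
    innerSL_apply_apply, map_mul, Pi.mul_apply]
  have : inner ℝ x (EuclideanSpace.single i (1 : ℝ)) = polyFun (X i) x := by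
    simp [polyFun_apply, EuclideanSpace.inner_single_right]
  rw [this]
  simp only [nsmul_eq_mul, Nat.cast_ofNat]
  ring

/-- A smooth function equal to `0` on `(-∞, 1]` and to `1` on `[2, ∞)`. -/
def cutoff (u : ℝ) : ℝ := Real.smoothTransition (u - 1)

theorem contDiff_cutoff : ContDiff ℝ ((⊤ : ℕ∞) : WithTop ℕ∞) cutoff :=
  Real.smoothTransition.contDiff.comp (contDiff_id.sub contDiff_const)

theorem cutoff_of_le_one {u : ℝ} (h : u ≤ 1) : cutoff u = 0 :=
  Real.smoothTransition.zero_of_nonpos (by linarith)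

theorem cutoff_of_two_le {u : ℝ} (h : 2 ≤ u) : cutoff u = 1 :=
  Real.smoothTransition.one_of_one_le (by linarith)

theorem norm_cutoff_le (u : ℝ) : ‖cutoff u‖ ≤ 1 := by
  rw [cutoff, Real.norm_of_nonneg (Real.smoothTransition.nonneg _)]
  exact Real.smoothTransition.le_one _

theorem continuous_deriv_cutoff : Continuous (deriv cutoff) :=
  contDiff_cutoff.continuous_deriv (by simp)

theorem deriv_cutoff_of_le_one {u : ℝ} (h : u < 1) : deriv cutoff u = 0 := by
  have : cutoff =ᶠ[nhds u] fun _ => 0 := by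
    filter_upwards [Iio_mem_nhds h] with v hv using cutoff_of_le_one (le_of_lt hv)
  rw [this.deriv_eq, deriv_const]

theorem deriv_cutoff_of_two_lt {u : ℝ} (h : 2 < u) : deriv cutoff u = 0 := by
  have : cutoff =ᶠ[nhds u] fun _ => 1 := by
    filter_upwards [Ioi_mem_nhds h] with v hv using cutoff_of_two_le (le_of_lt hv)
  rw [this.deriv_eq, deriv_const]

/-- The derivative is supported in `[1, 2]`. At `u = k (1 - t)` this controls the boundary layer
uniformly in `k`: the factor `k` from the chain rule is absorbed by one power of `1 - t`. -/
theorem exists_bound_mul_deriv_cutoff : ∃ C, ∀ u, ‖u * deriv cutoff u‖ ≤ C := by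
  obtain ⟨C, hC⟩ := (isCompact_Icc (a := (1 : ℝ)) (b := 2)).exists_bound_of_continuousOn
    (f := fun u => u * deriv cutoff u) (continuous_id.mul continuous_deriv_cutoff).continuousOn
  have hC0 : 0 ≤ C := (norm_nonneg _).trans (hC 1 (by norm_num))
  refine ⟨C, fun u => ?_⟩
  rcases lt_or_ge u 1 with h₁ | h₁
  · simpa [deriv_cutoff_of_le_one h₁] using hC0
  · rcases le_or_gt u 2 with h₂ | h₂
    · exact hC u ⟨h₁, h₂⟩
    · simpa [deriv_cutoff_of_two_lt h₂] using hC0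

/-- The truncation at distance about `1 / k` from `1` of `(1 - t) ^ ν`. -/
def cutoffPow (ν : ℝ) (k : ℕ) (t : ℝ) : ℝ := cutoff (k * (1 - t)) * (1 - t) ^ ν

theorem isRadialCutoff_cutoffPow (ν : ℝ) {k : ℕ} (hk : 0 < k) :
    IsRadialCutoff (cutoffPow ν k) := by
  have hk' : (0 : ℝ) < k := by exact_mod_cast hk
  have h0 : ∀ t, 1 - 1 / (k : ℝ) ≤ t → cutoffPow ν k t = 0 := fun t ht => by
    rw [cutoffPow, cutoff_of_le_one, zero_mul]
    have : 1 - t ≤ 1 / k := by linarith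
    rw [le_div_iff₀ hk'] at this
    linarith
  refine ⟨contDiff_iff_contDiffAt.2 fun t => ?_, 1 / k, by positivity, h0⟩
  -- The power is smooth only where its base is nonzero; for `t ≥ 1` the cutoff already vanishes on
  -- a neighbourhood.
  rcases lt_or_ge t 1 with ht | ht
  · refine ContDiffAt.mul (contDiff_cutoff.comp (by fun_prop)).contDiffAt ?_
    exact (by fun_prop : ContDiffAt ℝ _ (fun t : ℝ => 1 - t) t).rpow_const_of_ne (by linarith)
  · have : cutoffPow ν k =ᶠ[nhds t] fun _ => 0 := by
      have hlt : 1 - 1 / (k : ℝ) < t := by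
        have : 0 < 1 / (k : ℝ) := by positivity
        linarith
      filter_upwards [Ioi_mem_nhds hlt] with v hv using h0 v (le_of_lt hv)
    exact contDiffAt_const.congr_of_eventuallyEq this

theorem deriv_cutoffPow_add_one (ν : ℝ) (k : ℕ) {t : ℝ} (ht : t < 1) :
    deriv (cutoffPow (ν + 1) k) t =
      -(1 - t) ^ ν * (k * (1 - t) * deriv cutoff (k * (1 - t)) +
        (ν + 1) * cutoff (k * (1 - t))) := by
  have h₀ : HasDerivAt (fun t : ℝ => 1 - t) (-1) t := by
    simpa using (hasDerivAt_id t).const_sub 1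
  have h₁ : HasDerivAt (fun t : ℝ => cutoff (k * (1 - t)))
      (deriv cutoff (k * (1 - t)) * (k * -1)) t :=
    (contDiff_cutoff.differentiable (by simp) _).hasDerivAt.comp t (h₀.const_mul (k : ℝ))
  have h₂ := h₀.rpow_const (p := ν + 1) (Or.inl (by linarith))
  have h₃ : HasDerivAt (cutoffPow (ν + 1) k) _ t := h₁.mul h₂
  rw [h₃.deriv, Real.rpow_add_one (by linarith), add_sub_cancel_right]
  ring

/-- Dominated convergence: at each point of the open ball `k (1 - ‖x‖²)` eventually exceeds 2, where
`θ` is constant. -/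
theorem tendsto_integral_mul_cutoff {ν : ℝ} {F : Space d → ℝ}
    (hF : Integrable F (weightMeasure d ν)) {θ : ℝ → ℝ} (hθ : Continuous θ) {C c : ℝ}
    (hC : ∀ u, ‖θ u‖ ≤ C) (hc : ∀ u, 2 < u → θ u = c) :
    Filter.Tendsto (fun k : ℕ => ∫ x, F x * θ (k * (1 - ‖x‖ ^ 2)) ∂weightMeasure d ν)
      Filter.atTop (nhds (∫ x, F x * c ∂weightMeasure d ν)) := by
  refine tendsto_integral_of_dominated_convergence (fun x => ‖F x‖ * C) (fun k => ?_)
    (hF.norm.mul_const C) (fun k => Filter.Eventually.of_forall fun x => ?_) ?_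
  · exact hF.aestronglyMeasurable.mul (hθ.comp (by fun_prop)).aestronglyMeasurable
  · rw [norm_mul]
    exact mul_le_mul_of_nonneg_left (hC _) (norm_nonneg _)
  · filter_upwards [ae_mem_ball ν] with x hx
    have hpos := one_sub_normSq_pos hx
    refine tendsto_const_nhds.congr' ?_
    have := (tendsto_natCast_atTop_atTop (R := ℝ)).atTop_mul_const hpos
    filter_upwards [this.eventually_gt_atTop 2] with k hk
    rw [hc _ hk]

end Radial

/-! ### Weak integration by parts -/

section ByParts

variable {d : ℕ}

theorem setIntegral_mul_cutoffPow (ν : ℝ) (k : ℕ) (g : Space d → ℝ) (p : Poly d) :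
    ∫ x in Metric.ball (0 : Space d) 1, g x * (polyFun p x * cutoffPow ν k (‖x‖ ^ 2)) =
      ∫ x, g x * polyFun p x * cutoff (k * (1 - ‖x‖ ^ 2)) ∂weightMeasure d ν := by
  rw [integral_weightMeasure]
  refine setIntegral_congr_fun measurableSet_ball fun x _ => ?_
  simp only [cutoffPow, weight]
  ring

theorem tendsto_setIntegral_mul_cutoffPow [NeZero d] {ν : ℝ} (hν : -1 < ν) {g : Space d → ℝ}
    (hg : MemLp g 2 (weightMeasure d ν)) (p : Poly d) :
    Filter.Tendsto (fun k : ℕ => ∫ x in Metric.ball (0 : Space d) 1,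
      g x * (polyFun p x * cutoffPow ν k (‖x‖ ^ 2)))
      Filter.atTop (nhds (∫ x, g x * polyFun p x ∂weightMeasure d ν)) := by
  simp only [setIntegral_mul_cutoffPow]
  have := tendsto_integral_mul_cutoff (integrable_mul_polyFun hν hg p) contDiff_cutoff.continuous
    norm_cutoff_le (fun u hu => cutoff_of_two_le hu.le)
  simpa using this

theorem polyFun_partialAdjoint (ν : ℝ) (i : Fin d) (p : Poly d) (x : Space d) :
    polyFun (partialAdjoint ν i p) x =
      2 * (ν + 1) * polyFun (X i * p) x - (1 - ‖x‖ ^ 2) * polyFun (pderiv i p) x := by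
  rw [partialAdjoint_apply]
  simp [← polyFun_normSqPoly, mul_assoc]

/-- Test the weak derivative with `p` times the truncated weight of exponent `ν + 1` and let `k →
∞`. The gain of one in the exponent keeps the terms with a differentiated cutoff bounded against the
weight `ν`. -/
theorem WeakPartial.integral_mul_polyFun [NeZero d] {ν : ℝ} (hν : -1 < ν) {i : Fin d}
    {g h : Space d → ℝ} (hgh : WeakPartial i g h) (hg : MemLp g 2 (weightMeasure d ν))
    (hh : MemLp h 2 (weightMeasure d (ν + 1))) (p : Poly d) :
    ∫ x, h x * polyFun p x ∂weightMeasure d (ν + 1) =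
      ∫ x, g x * polyFun (partialAdjoint ν i p) x ∂weightMeasure d ν := by
  have h₁ := tendsto_setIntegral_mul_cutoffPow (by linarith : -1 < ν + 1) hh p
  refine tendsto_nhds_unique h₁ ?_
  obtain ⟨C, hC⟩ := exists_bound_mul_deriv_cutoff
  have i₁ := integrable_mul_polyFun hν hg (partialAdjoint ν i p)
  have i₂ := integrable_mul_polyFun hν hg ((2 : ℝ) • (X i * p))
  have h₂ := tendsto_integral_mul_cutoff i₁ contDiff_cutoff.continuous
    norm_cutoff_le (fun u hu => cutoff_of_two_le hu.le)
  -- The boundary layer: `u * deriv cutoff u` is zero for `u > 2`, so its contribution tends to 0.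
  have h₃ := tendsto_integral_mul_cutoff (c := 0) i₂ (continuous_id.mul continuous_deriv_cutoff)
    hC (fun u hu => by simp [deriv_cutoff_of_two_lt hu])
  have h₄ := h₂.add h₃
  simp only [mul_one, mul_zero, integral_zero, add_zero] at h₄
  refine h₄.congr' ?_
  filter_upwards [Filter.eventually_gt_atTop 0] with k hk
  have hψ := isRadialCutoff_cutoffPow (ν + 1) hk
  have h₅ := hgh.integral_eq _ (hψ.isTest p)
  rw [eq_neg_iff_add_eq_zero, add_comm, ← eq_neg_iff_add_eq_zero] at h₅
  rw [h₅, ← integral_neg, ← integral_add, integral_weightMeasure]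
  · refine setIntegral_congr_fun measurableSet_ball fun x hx => ?_
    have hx' := one_sub_normSq_pos hx
    simp only [hψ.classicalPartial_eq, polyFun_partialAdjoint]
    rw [deriv_cutoffPow_add_one ν k (by linarith), cutoffPow, Real.rpow_add_one hx'.ne']
    simp only [weight, map_smul, Pi.smul_apply, smul_eq_mul, Pi.mul_apply, id]
    ring
  · refine Integrable.mul_bdd (c := 1) i₁ ?_ (Filter.Eventually.of_forall fun x => norm_cutoff_le _)
    exact (contDiff_cutoff.continuous.comp (by fun_prop)).aestronglyMeasurable
  · refine Integrable.mul_bdd (c := C) i₂ ?_ (Filter.Eventually.of_forall fun x => hC _)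
    exact ((continuous_id.mul continuous_deriv_cutoff).comp (by fun_prop)).aestronglyMeasurable

theorem WeakPartial.setIntegral_mul_radial {i : Fin d} {g h : Space d → ℝ}
    (hgh : WeakPartial i g h) {ψ : ℝ → ℝ} (hψ : IsRadialCutoff ψ) (p : Poly d) :
    ∫ x in Metric.ball (0 : Space d) 1, h x * (polyFun p x * ψ (‖x‖ ^ 2)) =
      -∫ x in Metric.ball (0 : Space d) 1, g x * (polyFun (pderiv i p) x * ψ (‖x‖ ^ 2) +
        2 * polyFun (X i * p) x * deriv ψ (‖x‖ ^ 2)) := by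
  have h₅ := hgh.integral_eq _ (hψ.isTest p)
  simp only [hψ.classicalPartial_eq] at h₅
  linarith

/-- Rotations preserve radial functions: the two terms with `deriv ψ` carry `xⱼ xᵢ p` and `xᵢ xⱼ p`
with opposite signs. Hence the weight need not change, unlike for `∂ᵢ`. -/
theorem setIntegral_angular_mul_radial {i j : Fin d} (hij : i ≠ j) {g gi gj : Space d → ℝ}
    (hi : WeakPartial i g gi) (hj : WeakPartial j g gj) {ψ : ℝ → ℝ} (hψ : IsRadialCutoff ψ)
    (p : Poly d) :
    ∫ x in Metric.ball (0 : Space d) 1,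
        (x i * gj x - x j * gi x) * (polyFun p x * ψ (‖x‖ ^ 2)) =
      -∫ x in Metric.ball (0 : Space d) 1,
        g x * (polyFun (polyAngular i j p) x * ψ (‖x‖ ^ 2)) := by
  have e₁ := hj.setIntegral_mul_radial hψ (X i * p)
  have e₂ := hi.setIntegral_mul_radial hψ (X j * p)
  have i₁ := integrableOn_mul_of_isTest hj.right (hψ.isTest (X i * p))
  have i₂ := integrableOn_mul_of_isTest hi.right (hψ.isTest (X j * p))
  have i₃ : IntegrableOn (fun x => g x * (polyFun (pderiv j (X i * p)) x * ψ (‖x‖ ^ 2) +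
        2 * polyFun (X j * (X i * p)) x * deriv ψ (‖x‖ ^ 2))) (Metric.ball 0 1) := by
    simpa only [← hψ.classicalPartial_eq] using
      integrableOn_mul_of_isTest hj.left ((hψ.isTest (X i * p)).classicalPartial j)
  have i₄ : IntegrableOn (fun x => g x * (polyFun (pderiv i (X j * p)) x * ψ (‖x‖ ^ 2) +
        2 * polyFun (X i * (X j * p)) x * deriv ψ (‖x‖ ^ 2))) (Metric.ball 0 1) := by
    simpa only [← hψ.classicalPartial_eq] using
      integrableOn_mul_of_isTest hi.left ((hψ.isTest (X j * p)).classicalPartial i)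
  have e₃ : ∫ x in Metric.ball (0 : Space d) 1,
      (x i * gj x - x j * gi x) * (polyFun p x * ψ (‖x‖ ^ 2)) =
      (∫ x in Metric.ball (0 : Space d) 1, gj x * (polyFun (X i * p) x * ψ (‖x‖ ^ 2))) -
      ∫ x in Metric.ball (0 : Space d) 1, gi x * (polyFun (X j * p) x * ψ (‖x‖ ^ 2)) := by
    rw [← integral_sub i₁ i₂]
    refine setIntegral_congr_fun measurableSet_ball fun x _ => ?_
    simp only [polyFun_apply, map_mul, eval_X]
    ring
  rw [e₃, e₁, e₂, ← neg_sub_neg, neg_neg, neg_neg, ← integral_sub i₄ i₃, ← integral_neg]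
  refine setIntegral_congr_fun measurableSet_ball fun x _ => ?_
  simp only [polyFun_apply, polyAngular_apply, Derivation.leibniz, map_mul, map_sub, map_add,
    smul_eq_mul, eval_X, pderiv_X_eq, hij, hij.symm, if_false]
  simp only [mul_zero, add_zero, map_zero]
  ring

end ByParts

/-! ### Weighted Sobolev spaces, recursively -/

section Sobolev

variable {d : ℕ}

/-- The functions in the weighted `L²` space all of whose first order weak derivatives are,
recursively, in the Sobolev space of one order less, with the exponent of the weight raised
by one. -/
def Sob : ℕ → ℝ → (Space d → ℝ) → Prop
  | 0, ν, f => MemLp f 2 (weightMeasure d ν)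
  | r + 1, ν, f => MemLp f 2 (weightMeasure d ν) ∧
      ∀ i, ∃ g, WeakPartial i f g ∧ Sob r (ν + 1) g

theorem Sob.memLp {r : ℕ} {ν : ℝ} {f : Space d → ℝ} (h : Sob r ν f) :
    MemLp f 2 (weightMeasure d ν) := by
  cases r with
  | zero => exact h
  | succ r => exact h.1

theorem Sob.of_succ {r : ℕ} {ν : ℝ} {f : Space d → ℝ} (h : Sob (r + 1) ν f) : Sob r ν f := by
  induction r generalizing ν f with
  | zero => exact h.memLp
  | succ r ih =>
    refine ⟨h.memLp, fun i => ?_⟩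
    obtain ⟨g, hg, hs⟩ := h.2 i
    exact ⟨g, hg, ih hs⟩

theorem Sob.mono_weight {r : ℕ} {ν ν' : ℝ} (hν : ν ≤ ν') {f : Space d → ℝ} (h : Sob r ν f) :
    Sob r ν' f := by
  induction r generalizing ν ν' f with
  | zero => exact MemLp.mono_measure (weightMeasure_anti hν) h
  | succ r ih =>
    refine ⟨h.memLp.mono_measure (weightMeasure_anti hν), fun i => ?_⟩
    obtain ⟨g, hg, hs⟩ := h.2 i
    exact ⟨g, hg, ih (by linarith) hs⟩

theorem Sob.congr {r : ℕ} {ν : ℝ} {f f' : Space d → ℝ} (h : Sob r ν f)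
    (hf : f =ᵐ[volume.restrict (Metric.ball 0 1)] f') : Sob r ν f' := by
  have hf' := (weightMeasure_absolutelyContinuous ν).ae_le hf
  cases r with
  | zero => exact MemLp.ae_eq hf' h
  | succ r =>
    refine ⟨h.memLp.ae_eq hf', fun i => ?_⟩
    obtain ⟨g, hg, hs⟩ := h.2 i
    exact ⟨g, hg.congr hf Filter.EventuallyEq.rfl, hs⟩

theorem Sob.add {r : ℕ} {ν : ℝ} {f f' : Space d → ℝ} (h : Sob r ν f) (h' : Sob r ν f') :
    Sob r ν (f + f') := by
  induction r generalizing ν f f' with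
  | zero => exact MemLp.add h h'
  | succ r ih =>
    refine ⟨h.memLp.add h'.memLp, fun i => ?_⟩
    obtain ⟨g, hg, hs⟩ := h.2 i
    obtain ⟨g', hg', hs'⟩ := h'.2 i
    exact ⟨g + g', hg.add hg', ih hs hs'⟩

theorem Sob.polyFun_mul {r : ℕ} {ν : ℝ} {f : Space d → ℝ} (h : Sob r ν f) (p : Poly d) :
    Sob r ν (fun x => polyFun p x * f x) := by
  induction r generalizing ν f p with
  | zero => exact memLp_mul_polyFun h p
  | succ r ih =>
    refine ⟨memLp_mul_polyFun h.memLp p, fun i => ?_⟩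
    obtain ⟨g, hg, hs⟩ := h.2 i
    -- In the product rule the term with `f` undifferentiated has one order to spare and the smaller
    -- exponent, so it is weakened in both.
    exact ⟨_, hg.polyFun_mul p,
      (ih hs p).add (ih (h.of_succ.mono_weight (by linarith)) (pderiv i p))⟩

theorem weakPartial_zero (i : Fin d) : WeakPartial i (0 : Space d → ℝ) 0 := by
  simpa using weakPartial_polyFun i (0 : Poly d)

theorem sob_zero (r : ℕ) (ν : ℝ) : Sob r ν (0 : Space d → ℝ) := by
  induction r generalizing ν with
  | zero => exact MemLp.zero
  | succ r ih => exact ⟨MemLp.zero, fun i => ⟨0, weakPartial_zero i, ih _⟩⟩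

theorem Sob.sum {r : ℕ} {ν : ℝ} {ι : Type*} (s : Finset ι) {f : ι → Space d → ℝ}
    (h : ∀ i ∈ s, Sob r ν (f i)) : Sob r ν (∑ i ∈ s, f i) := by
  classical
  induction s using Finset.induction_on with
  | empty => simpa using sob_zero r ν
  | insert a s ha ih =>
    rw [Finset.sum_insert ha]
    exact (h a (Finset.mem_insert_self a s)).add
      (ih fun i hi => h i (Finset.mem_insert_of_mem hi))

theorem sum_single_add (m : Fin d → ℕ) (i : Fin d) :
    ∑ j, (m + Pi.single i 1 : Fin d → ℕ) j = ∑ j, m j + 1 := by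
  simp [Finset.sum_add_distrib]

/-- Passes from multi-indices to one derivative at a time, the form suited to induction: the weak
derivative of `f` of index `m + eᵢ` is the weak derivative of index `m` of `∂ᵢ f`. -/
theorem MemSobolevBall.sob [NeZero d] {r : ℕ} {ν : ℝ} (hν : -1 < ν) {f : Space d → ℝ}
    (h : MemSobolevBall r ν f) : Sob r ν f := by
  induction r generalizing ν f with
  | zero => exact (memLp_ballMeasure_iff hν f).1 h.1
  | succ r ih =>
    refine ⟨(memLp_ballMeasure_iff hν f).1 h.1, fun i => ?_⟩
    obtain ⟨g, hg, hgm⟩ := h.2 (Pi.single i 1) (by simp)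
    have hw := hasWeakDeriv_single_one_iff.1 hg
    have hsum : ∑ j, ((Pi.single i 1 : Fin d → ℕ) j : ℝ) = 1 := by
      rw [← Nat.cast_sum]; simp
    rw [hsum] at hgm
    refine ⟨g, hw, ih (by linarith) ⟨hgm, fun m hm => ?_⟩⟩
    obtain ⟨G, hG, hGm⟩ := h.2 (m + Pi.single i 1) (by rw [sum_single_add]; omega)
    refine ⟨G, ⟨hg.2.1, hG.2.1, fun φ => ?_⟩, ?_⟩
    · have hφ := isTest_coe φ
      -- The definition of `∂ᵢ f` is tested with the classical derivative of `φ` of index `m`, again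
      -- a test function.
      have h₁ := hw.integral_eq _ (hφ.classicalDeriv m)
      have h₂ := hG.2.2 φ
      rw [classicalPartial_classicalDeriv i m hφ.contDiff, h₂, sum_single_add, pow_succ] at h₁
      linarith
    · convert hGm using 2
      rw [← Nat.cast_sum, ← Nat.cast_sum, sum_single_add]
      push_cast
      ring

theorem WeakPartial.weakDeriv_ae_eq {i : Fin d} {f g : Space d → ℝ} (h : WeakPartial i f g) :
    weakDeriv (Pi.single i 1) f =ᵐ[volume.restrict (Metric.ball 0 1)] g :=
  (hasWeakDeriv_single_one_iff.2 h).weakDeriv_ae_eq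

/-! ### The Laplace operator -/

theorem Sob.exists_laplace {r : ℕ} {ν : ℝ} {f : Space d → ℝ} (h : Sob (r + 2) ν f) :
    ∃ g G : Fin d → Space d → ℝ, (∀ i, WeakPartial i f (g i)) ∧ (∀ i, Sob (r + 1) (ν + 1) (g i)) ∧
      (∀ i, WeakPartial i (g i) (G i)) ∧ (∀ i, Sob r (ν + 1 + 1) (G i)) ∧
      laplace f =ᵐ[volume.restrict (Metric.ball 0 1)] ∑ i, G i := by
  choose g hg hgs using h.2
  choose G hG hGs using fun i => (hgs i).2 i
  refine ⟨g, G, hg, hgs, hG, hGs, ?_⟩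
  have := fun i => ((hg i).hasWeakDeriv_single_two (hG i)).weakDeriv_ae_eq
  filter_upwards [ae_all_iff.2 this] with x hx
  rw [laplace, Finset.sum_apply]
  exact Finset.sum_congr rfl fun i _ => hx i

theorem Sob.laplace {r : ℕ} {ν : ℝ} {f : Space d → ℝ} (h : Sob (r + 2) ν f) :
    Sob r (ν + 2) (laplace f) := by
  obtain ⟨g, G, -, -, -, hGs, he⟩ := h.exists_laplace
  rw [show ν + 2 = ν + 1 + 1 by ring]
  exact (Sob.sum _ fun i _ => hGs i).congr he.symm

theorem Sob.integral_laplace_mul_polyFun [NeZero d] {ν : ℝ} (hν : -1 < ν) {f : Space d → ℝ}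
    {r : ℕ} (h : Sob (r + 2) ν f) (p : Poly d) :
    ∫ x, BallApprox.laplace f x * polyFun p x ∂weightMeasure d (ν + 2) =
      ∫ x, f x * polyFun (laplaceAdjoint ν p) x ∂weightMeasure d ν := by
  obtain ⟨g, G, hg, hgs, hG, hGs, he⟩ := h.exists_laplace
  rw [show ν + 2 = ν + 1 + 1 by ring]
  have he' : BallApprox.laplace f =ᵐ[weightMeasure d (ν + 1 + 1)] ∑ i, G i :=
    (weightMeasure_absolutelyContinuous (ν + 1 + 1)).ae_le he
  rw [integral_congr_ae (g := fun x => ∑ i, G i x * polyFun p x) (he'.mono fun x hx => by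
    simp only [hx, Finset.sum_apply, Finset.sum_mul])]
  rw [integral_finsetSum _ fun i _ => integrable_mul_polyFun (by linarith) (hGs i).memLp p]
  have h₁ : ∀ i, ∫ x, G i x * polyFun p x ∂weightMeasure d (ν + 1 + 1) =
      ∫ x, f x * polyFun (partialAdjoint ν i (partialAdjoint (ν + 1) i p)) x
        ∂weightMeasure d ν := fun i => by
    rw [(hG i).integral_mul_polyFun (by linarith) (hgs i).memLp (hGs i).memLp,
      (hg i).integral_mul_polyFun hν h.memLp (hgs i).memLp]
  simp only [h₁, laplaceAdjoint_apply, map_sum, Finset.sum_apply, Finset.mul_sum]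
  rw [integral_finsetSum _ fun i _ => integrable_mul_polyFun hν h.memLp _]

theorem Sob.laplace_iterate {ν : ℝ} {f : Space d → ℝ} (s : ℕ) (h : Sob (2 * s) ν f) :
    MemLp (BallApprox.laplace^[s] f) 2 (weightMeasure d (ν + 2 * s)) := by
  induction s generalizing ν f with
  | zero => simpa using h.memLp
  | succ s ih =>
    have := ih (ν := ν + 2) (Sob.laplace (r := 2 * s) h)
    rw [Function.iterate_succ_apply]
    convert this using 2
    push_cast; ring

theorem Sob.integral_laplace_iterate_mul_polyFun [NeZero d] {ν : ℝ} (hν : -1 < ν)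
    {f : Space d → ℝ} (s : ℕ) (h : Sob (2 * s) ν f) (p : Poly d) :
    ∫ x, (BallApprox.laplace^[s] f) x * polyFun p x ∂weightMeasure d (ν + 2 * s) =
      ∫ x, f x * polyFun (laplacePowAdjoint s ν p) x ∂weightMeasure d ν := by
  induction s generalizing ν f with
  | zero => simp [laplacePowAdjoint]
  | succ s ih =>
    have h₁ := ih (ν := ν + 2) (by linarith) (Sob.laplace (r := 2 * s) h)
    rw [show ν + 2 * ((s + 1 : ℕ) : ℝ) = ν + 2 + 2 * s by push_cast; ring,
      Function.iterate_succ_apply, h₁, Sob.integral_laplace_mul_polyFun hν (r := 2 * s) h]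
    rfl

/-! ### The Laplace–Beltrami operator -/

/-- As a Sobolev function an angular derivative is controlled only with exponent `ν + 1`. The
by-parts identity is therefore stated against compactly supported radial factors, where no weighted
integrability is needed. -/
theorem Sob.angularDeriv {r : ℕ} {ν : ℝ} {f : Space d → ℝ} (h : Sob (r + 1) ν f) {i j : Fin d}
    (hij : i ≠ j) :
    Sob r (ν + 1) (angularDeriv i j f) ∧
      LocallyIntegrableOn (BallApprox.angularDeriv i j f) (Metric.ball 0 1) volume ∧
      ∀ ψ, IsRadialCutoff ψ → ∀ p : Poly d,
        ∫ x in Metric.ball (0 : Space d) 1,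
          BallApprox.angularDeriv i j f x * (polyFun p x * ψ (‖x‖ ^ 2)) =
        -∫ x in Metric.ball (0 : Space d) 1,
          f x * (polyFun (polyAngular i j p) x * ψ (‖x‖ ^ 2)) := by
  obtain ⟨gi, hi, hsi⟩ := h.2 i
  obtain ⟨gj, hj, hsj⟩ := h.2 j
  have he : BallApprox.angularDeriv i j f =ᵐ[volume.restrict (Metric.ball 0 1)]
      fun x => x i * gj x - x j * gi x := by
    filter_upwards [hi.weakDeriv_ae_eq, hj.weakDeriv_ae_eq] with x h₁ h₂
    rw [BallApprox.angularDeriv, h₁, h₂]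
  have he' : (fun x : Space d => x i * gj x - x j * gi x) =
      (fun x => polyFun (X i) x * gj x) + fun x => polyFun (-X j) x * gi x := by
    ext x
    simp [polyFun_apply, sub_eq_add_neg]
  refine ⟨?_, ?_, fun ψ hψ p => ?_⟩
  · refine Sob.congr ?_ he.symm
    rw [he']
    exact (hsj.polyFun_mul _).add (hsi.polyFun_mul _)
  · refine LocallyIntegrableOn.congr he.symm ?_
    rw [he']
    exact (locallyIntegrableOn_polyFun_mul _ hj.2).add (locallyIntegrableOn_polyFun_mul _ hi.2)
  · rw [← setIntegral_angular_mul_radial hij hi hj hψ p]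
    exact integral_congr_ae (he.mono fun x hx => by simp only [hx])

theorem Sob.laplaceBeltrami {r : ℕ} {ν : ℝ} {f : Space d → ℝ} (h : Sob (r + 2) ν f) :
    Sob r (ν + 2) (laplaceBeltrami f) ∧
      ∀ ψ, IsRadialCutoff ψ → ∀ p : Poly d,
        ∫ x in Metric.ball (0 : Space d) 1,
          BallApprox.laplaceBeltrami f x * (polyFun p x * ψ (‖x‖ ^ 2)) =
        ∫ x in Metric.ball (0 : Space d) 1,
          f x * (polyFun (polyBeltrami p) x * ψ (‖x‖ ^ 2)) := by
  have hne : ∀ i j : Fin d, j ∈ Finset.univ.filter (i < ·) → i ≠ j := fun i j hj =>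
    (Finset.mem_filter.1 hj).2.ne
  have h₁ := fun i j hj => h.angularDeriv (hne i j hj)
  have h₂ := fun i j hj => (h₁ i j hj).1.angularDeriv (hne i j hj)
  have he : BallApprox.laplaceBeltrami f = ∑ i, ∑ j with i < j,
      BallApprox.angularDeriv i j (BallApprox.angularDeriv i j f) := by
    ext x
    simp only [BallApprox.laplaceBeltrami, Finset.sum_apply]
  refine ⟨?_, fun ψ hψ p => ?_⟩
  · rw [he, show ν + 2 = ν + 1 + 1 by ring]
    exact Sob.sum _ fun i _ => Sob.sum _ fun j hj => (h₂ i j hj).1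
  -- Local integrability of `f` is read off from one of its first derivatives, which requires an
  -- index; for `d = 0` both sums are empty.
  · have hf : LocallyIntegrableOn f (Metric.ball 0 1) volume ∨ IsEmpty (Fin d) := by
      rcases isEmpty_or_nonempty (Fin d) with h0 | ⟨⟨i⟩⟩
      · exact Or.inr h0
      · obtain ⟨g, hg, -⟩ := h.2 i
        exact Or.inl hg.1
    rcases hf with hf | h0
    · simp only [he, polyBeltrami_apply, map_sum, Finset.sum_apply, Finset.sum_mul,
        Finset.mul_sum]
      rw [integral_finsetSum _ fun i _ => integrable_finsetSum _ fun j hj =>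
          integrableOn_mul_of_isTest (h₂ i j hj).2.1 (hψ.isTest p),
        integral_finsetSum _ fun i _ => integrable_finsetSum _ fun j hj =>
          integrableOn_mul_of_isTest hf (hψ.isTest _)]
      refine Finset.sum_congr rfl fun i _ => ?_
      rw [integral_finsetSum _ fun j hj =>
          integrableOn_mul_of_isTest (h₂ i j hj).2.1 (hψ.isTest p),
        integral_finsetSum _ fun j hj => integrableOn_mul_of_isTest hf (hψ.isTest _)]
      refine Finset.sum_congr rfl fun j hj => ?_
      rw [(h₂ i j hj).2.2 ψ hψ p, (h₁ i j hj).2.2 ψ hψ, neg_neg]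
    · simp [he, polyBeltrami_apply]

theorem Sob.laplaceBeltrami_iterate {ν : ℝ} {f : Space d → ℝ} (s : ℕ) (h : Sob (2 * s) ν f) :
    MemLp (BallApprox.laplaceBeltrami^[s] f) 2 (weightMeasure d (ν + 2 * s)) ∧
      ∀ ψ, IsRadialCutoff ψ → ∀ p : Poly d,
        ∫ x in Metric.ball (0 : Space d) 1,
          (BallApprox.laplaceBeltrami^[s] f) x * (polyFun p x * ψ (‖x‖ ^ 2)) =
        ∫ x in Metric.ball (0 : Space d) 1,
          f x * (polyFun (polyBeltrami^[s] p) x * ψ (‖x‖ ^ 2)) := by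
  induction s generalizing ν f with
  | zero => exact ⟨by simpa using h.memLp, fun _ _ _ => rfl⟩
  | succ s ih =>
    obtain ⟨h₁, h₂⟩ := Sob.laplaceBeltrami (r := 2 * s) h
    obtain ⟨h₃, h₄⟩ := ih h₁
    refine ⟨?_, fun ψ hψ p => ?_⟩
    · rw [Function.iterate_succ_apply]
      convert h₃ using 2
      push_cast; ring
    · rw [Function.iterate_succ_apply, h₄ ψ hψ, h₂ ψ hψ, Function.iterate_succ_apply']

theorem Sob.aestronglyMeasurable_laplaceBeltrami_iterate {ν : ℝ} {f : Space d → ℝ} (s : ℕ)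
    (h : Sob (2 * s) ν f) :
    AEStronglyMeasurable (BallApprox.laplaceBeltrami^[s] f) (weightMeasure d ν) :=
  (((h.laplaceBeltrami_iterate s).1.aestronglyMeasurable).mono_ac
    (absolutelyContinuous_weightMeasure _)).mono_ac (weightMeasure_absolutelyContinuous ν)

/-- The cutoff is removed only once, after all `s` applications, so integrability for the weight `ν`
is required of the final function `Δ₀^s f` and of `f`, not of the intermediate ones. -/
theorem Sob.integral_laplaceBeltrami_iterate_mul_polyFun [NeZero d] {ν : ℝ} (hν : -1 < ν)
    {f : Space d → ℝ} (s : ℕ) (h : Sob (2 * s) ν f)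
    (hm : MemLp (BallApprox.laplaceBeltrami^[s] f) 2 (weightMeasure d ν)) (p : Poly d) :
    ∫ x, (BallApprox.laplaceBeltrami^[s] f) x * polyFun p x ∂weightMeasure d ν =
      ∫ x, f x * polyFun (polyBeltrami^[s] p) x ∂weightMeasure d ν := by
  have h₁ := tendsto_setIntegral_mul_cutoffPow hν hm p
  have h₂ := tendsto_setIntegral_mul_cutoffPow hν h.memLp (polyBeltrami^[s] p)
  refine tendsto_nhds_unique h₁ (h₂.congr' ?_)
  filter_upwards [Filter.eventually_gt_atTop 0] with k hk
  exact ((h.laplaceBeltrami_iterate s).2 _ (isRadialCutoff_cutoffPow ν hk) p).symm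

/-! ### Integration by parts for polynomials -/

/-- The inner product of polynomials for the weight `ν`. -/
def polyInner (ν : ℝ) (p q : Poly d) : ℝ := ∫ x, polyFun p x * polyFun q x ∂weightMeasure d ν

theorem polyInner_comm (ν : ℝ) (p q : Poly d) : polyInner ν p q = polyInner ν q p := by
  simp only [polyInner, mul_comm]

theorem polyInner_add_left [NeZero d] {ν : ℝ} (hν : -1 < ν) (p q r : Poly d) :
    polyInner ν (p + q) r = polyInner ν p r + polyInner ν q r := by
  simp only [polyInner, map_add, Pi.add_apply, add_mul]
  exact integral_add (integrable_mul_polyFun hν (memLp_polyFun hν p) r)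
    (integrable_mul_polyFun hν (memLp_polyFun hν q) r)

theorem polyInner_smul_left (ν : ℝ) (a : ℝ) (p q : Poly d) :
    polyInner ν (a • p) q = a * polyInner ν p q := by
  simp only [polyInner, map_smul, Pi.smul_apply, smul_eq_mul, mul_assoc, integral_const_mul]

theorem polyInner_sum_left [NeZero d] {ν : ℝ} (hν : -1 < ν) {ι : Type*} (s : Finset ι)
    (p : ι → Poly d) (q : Poly d) :
    polyInner ν (∑ i ∈ s, p i) q = ∑ i ∈ s, polyInner ν (p i) q := by
  simp only [polyInner, map_sum, Finset.sum_apply, Finset.sum_mul]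
  exact integral_finsetSum _ fun i _ => integrable_mul_polyFun hν (memLp_polyFun hν _) q

theorem polyInner_self_nonneg (ν : ℝ) (p : Poly d) : 0 ≤ polyInner ν p p :=
  integral_nonneg fun x => mul_self_nonneg (polyFun p x)

theorem polyInner_pderiv [NeZero d] {ν : ℝ} (hν : -1 < ν) (i : Fin d) (p q : Poly d) :
    polyInner (ν + 1) (pderiv i p) q = polyInner ν p (partialAdjoint ν i q) :=
  (weakPartial_polyFun i p).integral_mul_polyFun hν (memLp_polyFun hν p)
    (memLp_polyFun (by linarith) _) q

theorem polyInner_polyLaplace [NeZero d] {ν : ℝ} (hν : -1 < ν) (p q : Poly d) :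
    polyInner (ν + 2) (polyLaplace p) q = polyInner ν p (laplaceAdjoint ν q) := by
  rw [polyLaplace_apply, laplaceAdjoint_apply, polyInner_comm ν p, polyInner_sum_left hν,
    polyInner_sum_left (by linarith), show ν + 2 = ν + 1 + 1 by ring]
  refine Finset.sum_congr rfl fun i _ => ?_
  rw [polyInner_pderiv (by linarith), polyInner_pderiv hν, polyInner_comm]

theorem polyInner_polyLaplace_iterate [NeZero d] {ν : ℝ} (hν : -1 < ν) (s : ℕ) (p q : Poly d) :
    polyInner (ν + 2 * s) (polyLaplace^[s] p) q = polyInner ν p (laplacePowAdjoint s ν q) := by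
  induction s generalizing ν p with
  | zero => simp [laplacePowAdjoint]
  | succ s ih =>
    rw [show ν + 2 * ((s + 1 : ℕ) : ℝ) = ν + 2 + 2 * s by push_cast; ring,
      Function.iterate_succ_apply, ih (by linarith), polyInner_polyLaplace hν]
    rfl

theorem polyInner_polyAngular [NeZero d] {ν : ℝ} (hν : -1 < ν) {i j : Fin d} (hij : i ≠ j)
    (p q : Poly d) :
    polyInner ν (polyAngular i j p) q = -polyInner ν p (polyAngular i j q) := by
  have h₁ := tendsto_setIntegral_mul_cutoffPow hν (memLp_polyFun hν (polyAngular i j p)) q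
  have h₂ := tendsto_setIntegral_mul_cutoffPow hν (memLp_polyFun hν p) (polyAngular i j q)
  refine tendsto_nhds_unique h₁ (h₂.neg.congr' ?_)
  filter_upwards [Filter.eventually_gt_atTop 0] with k hk
  rw [← setIntegral_angular_mul_radial hij (weakPartial_polyFun i p) (weakPartial_polyFun j p)
    (isRadialCutoff_cutoffPow ν hk) q]
  refine setIntegral_congr_fun measurableSet_ball fun x _ => ?_
  simp [polyFun_apply, polyAngular_apply]

theorem polyInner_polyBeltrami_eq_neg_sum [NeZero d] {ν : ℝ} (hν : -1 < ν) (p q : Poly d) :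
    polyInner ν (polyBeltrami p) q =
      -∑ i, ∑ j with i < j, polyInner ν (polyAngular i j p) (polyAngular i j q) := by
  rw [polyBeltrami_apply, polyInner_sum_left hν, ← Finset.sum_neg_distrib]
  refine Finset.sum_congr rfl fun i _ => ?_
  rw [polyInner_sum_left hν, ← Finset.sum_neg_distrib]
  exact Finset.sum_congr rfl fun j hj =>
    polyInner_polyAngular hν (Finset.mem_filter.1 hj).2.ne _ _

theorem polyInner_polyBeltrami [NeZero d] {ν : ℝ} (hν : -1 < ν) (p q : Poly d) :
    polyInner ν (polyBeltrami p) q = polyInner ν p (polyBeltrami q) := by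
  rw [polyInner_comm ν p, polyInner_polyBeltrami_eq_neg_sum hν,
    polyInner_polyBeltrami_eq_neg_sum hν]
  simp only [polyInner_comm]

theorem polyInner_polyBeltrami_iterate [NeZero d] {ν : ℝ} (hν : -1 < ν) (s : ℕ) (p q : Poly d) :
    polyInner ν (polyBeltrami^[s] p) q = polyInner ν p (polyBeltrami^[s] q) := by
  induction s generalizing p with
  | zero => rfl
  | succ s ih =>
    rw [Function.iterate_succ_apply, ih, polyInner_polyBeltrami hν, Function.iterate_succ_apply']

/-- Both parts of `Δ₀ - ∑ ∂ᵢ* ∂ᵢ` are symmetric. -/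
theorem polyInner_jacobiOp [NeZero d] {ν : ℝ} (hν : -1 < ν) (p q : Poly d) :
    polyInner ν (jacobiOp ν p) q = polyInner ν p (jacobiOp ν q) := by
  have hJ : ∀ p : Poly d, jacobiOp ν p =
      polyBeltrami p + (-1 : ℝ) • ∑ i, partialAdjoint ν i (pderiv i p) := fun p => by
    rw [sum_partialAdjoint_pderiv]; module
  have h : ∀ p q : Poly d, polyInner ν (∑ i, partialAdjoint ν i (pderiv i p)) q =
      ∑ i, polyInner (ν + 1) (pderiv i q) (pderiv i p) := fun p q => by
    rw [polyInner_sum_left hν]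
    exact Finset.sum_congr rfl fun i _ => by rw [polyInner_pderiv hν, polyInner_comm]
  rw [polyInner_comm ν p, hJ p, hJ q, polyInner_add_left hν, polyInner_add_left hν,
    polyInner_smul_left, polyInner_smul_left, h, h, polyInner_polyBeltrami hν p,
    polyInner_comm ν p]
  simp only [polyInner_comm]

end Sobolev

/-! ### A spectral lower bound -/

theorem exists_inner_eq_of_core {E : Type*} [AddCommGroup E] [Module ℝ E] [FiniteDimensional ℝ E]
    (I : InnerProductSpace.Core ℝ E) (φ : E →ₗ[ℝ] ℝ) : ∃ p, ∀ q, I.inner p q = φ q := by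
  let _ : NormedAddCommGroup E := I.toNormedAddCommGroup
  let _ : InnerProductSpace ℝ E := InnerProductSpace.ofCore I.toCore
  have : CompleteSpace E := FiniteDimensional.complete ℝ E
  exact ⟨(InnerProductSpace.toDual ℝ E).symm (LinearMap.toContinuousLinearMap φ),
    fun q => InnerProductSpace.toDual_symm_apply (y := LinearMap.toContinuousLinearMap φ)⟩

/-- The spectral theorem gives an orthonormal eigenbasis of `T`; in it `β` is diagonal with entries
at least `c`. -/
theorem mul_inner_self_le_of_core {E : Type*} [AddCommGroup E] [Module ℝ E]
    [FiniteDimensional ℝ E] (I : InnerProductSpace.Core ℝ E) {T : E →ₗ[ℝ] E}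
    (hT : ∀ p q, I.inner (T p) q = I.inner p (T q)) (β : E →ₗ[ℝ] E →ₗ[ℝ] ℝ) {c : ℝ}
    (h : ∀ (v : E) (l : ℝ), v ≠ 0 → T v = l • v →
      ∃ σ, c ≤ σ ∧ ∀ w, β v w = σ * I.inner v w) (v : E) :
    c * I.inner v v ≤ β v v := by
  let _ : NormedAddCommGroup E := I.toNormedAddCommGroup
  let _ : InnerProductSpace ℝ E := InnerProductSpace.ofCore I.toCore
  have hT : T.IsSymmetric := hT
  set b := hT.eigenvectorBasis rfl
  have h₁ : ∀ i, ∃ σ, c ≤ σ ∧ ∀ w, β (b i) w = σ * inner ℝ (b i) w := fun i =>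
    h (b i) (hT.eigenvalues rfl i) (b.orthonormal.ne_zero i) (hT.apply_eigenvectorBasis rfl i)
  choose σ hσ hβ using h₁
  have e₁ : β v v = ∑ i, σ i * inner ℝ (b i) v ^ 2 := by
    conv_lhs => enter [1]; rw [← b.sum_repr' v]
    rw [map_sum, LinearMap.sum_apply]
    refine Finset.sum_congr rfl fun i _ => ?_
    rw [map_smul, LinearMap.smul_apply, hβ, smul_eq_mul]
    ring
  have e₂ : inner ℝ v v = ∑ i, inner ℝ (b i) v ^ 2 := by
    conv_lhs => enter [2]; rw [← b.sum_repr' v]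
    rw [sum_inner]
    refine Finset.sum_congr rfl fun i _ => ?_
    rw [inner_smul_left, conj_trivial, pow_two]
  show c * inner ℝ v v ≤ β v v
  rw [e₁, e₂, Finset.mul_sum]
  exact Finset.sum_le_sum fun i _ => mul_le_mul_of_nonneg_right (hσ i) (sq_nonneg _)

section Spectral

variable {d : ℕ}

/-- A space of polynomials as an inner product space, for the weight `ν`. -/
abbrev polyCore [NeZero d] {ν : ℝ} (hν : -1 < ν) (K : Submodule ℝ (Poly d)) :
    InnerProductSpace.Core ℝ K where
  inner p q := polyInner ν (p : Poly d) q
  conj_inner_symm p q := polyInner_comm ν (q : Poly d) p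
  re_inner_nonneg p := polyInner_self_nonneg ν (p : Poly d)
  add_left p q r := polyInner_add_left hν (p : Poly d) q r
  smul_left p q a := polyInner_smul_left ν a (p : Poly d) q
  definite _ h := Subtype.ext (eq_zero_of_integral_sq_eq_zero hν h)

/-- The orthogonal projection of `f`, obtained as the Riesz representative of `q ↦ ∫ f q` on a
finite-dimensional space. -/
theorem exists_best_approximation [NeZero d] {ν : ℝ} (hν : -1 < ν) {f : Space d → ℝ}
    (hf : MemLp f 2 (weightMeasure d ν)) (n : ℕ) :
    ∃ p ∈ PolyLE d n, ∀ q ∈ PolyLE d n,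
      ∫ x, f x * polyFun q x ∂weightMeasure d ν = polyInner ν p q := by
  let φ : PolyLE d n →ₗ[ℝ] ℝ :=
    { toFun := fun q => ∫ x, f x * polyFun (q : Poly d) x ∂weightMeasure d ν
      map_add' := fun p q => by
        simp only [Submodule.coe_add, map_add, Pi.add_apply, mul_add]
        exact integral_add (integrable_mul_polyFun hν hf _) (integrable_mul_polyFun hν hf _)
      map_smul' := fun a p => by
        simp only [Submodule.coe_smul, map_smul, Pi.smul_apply, smul_eq_mul, RingHom.id_apply]
        rw [← integral_const_mul]
        congr 1; ext x; ring }
  obtain ⟨p, hp⟩ := exists_inner_eq_of_core (polyCore hν (PolyLE d n)) φ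
  exact ⟨p, p.2, fun q hq => (hp ⟨q, hq⟩).symm⟩

theorem polyInner_sub_left [NeZero d] {ν : ℝ} (hν : -1 < ν) (p q r : Poly d) :
    polyInner ν (p - q) r = polyInner ν p r - polyInner ν q r := by
  rw [sub_eq_add_neg, ← neg_one_smul ℝ q, polyInner_add_left hν, polyInner_smul_left]
  ring

theorem polyInner_sub_left_eq_zero_of_best [NeZero d] {ν : ℝ} (hν : -1 < ν) (p : Poly d) (n : ℕ) :
    ∃ q ∈ PolyLE d n, ∀ r ∈ PolyLE d n, polyInner ν (p - q) r = 0 := by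
  obtain ⟨q, hq, h⟩ := exists_best_approximation hν (memLp_polyFun hν p) n
  refine ⟨q, hq, fun r hr => ?_⟩
  rw [polyInner_sub_left hν, ← h r hr, polyInner, sub_self]

/-- Triangularity puts `jacobiOp p + m (m + 2ν + d) p` in degree at most `m - 1`; symmetry makes it
orthogonal to that space, hence to itself. -/
theorem jacobiOp_eq_smul_of_orthogonal [NeZero d] {ν : ℝ} (hν : -1 < ν) {m : ℕ} (hm : 1 ≤ m)
    {p : Poly d} (hp : p ∈ PolyLE d m) (ho : ∀ q ∈ PolyLE d (m - 1), polyInner ν p q = 0) :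
    jacobiOp ν p = -((m : ℝ) * (m + 2 * ν + d)) • p := by
  have h₁ := jacobiOp_add_smul_mem_polyLE hm ν hp
  have h₂ : ∀ q ∈ PolyLE d (m - 1),
      polyInner ν (jacobiOp ν p + ((m : ℝ) * (m + 2 * ν + d)) • p) q = 0 := fun q hq => by
    rw [polyInner_add_left hν, polyInner_smul_left, polyInner_jacobiOp hν, ho q hq,
      ho _ (jacobiOp_mem_polyLE ν hq)]
    simp
  have h₃ := eq_zero_of_integral_sq_eq_zero hν (h₂ _ h₁)
  rw [neg_smul]
  exact eq_neg_of_add_eq_zero_left h₃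

/-- The polynomials of degree at most `m` orthogonal to those of lower degree. -/
def orthoPoly [NeZero d] {ν : ℝ} (hν : -1 < ν) (m : ℕ) : Submodule ℝ (Poly d) where
  carrier := {p | p ∈ PolyLE d m ∧ ∀ q ∈ PolyLE d (m - 1), polyInner ν p q = 0}
  add_mem' := fun hp hq => ⟨add_mem hp.1 hq.1, fun r hr => by
    rw [polyInner_add_left hν, hp.2 r hr, hq.2 r hr, add_zero]⟩
  zero_mem' := ⟨zero_mem _, fun r _ => by simp [polyInner]⟩
  smul_mem' := fun a p hp => ⟨Submodule.smul_mem _ a hp.1, fun r hr => by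
    rw [polyInner_smul_left, hp.2 r hr, mul_zero]⟩

theorem polyBeltrami_mem_orthoPoly [NeZero d] {ν : ℝ} (hν : -1 < ν) (m : ℕ) :
    ∀ p ∈ orthoPoly (d := d) hν m, polyBeltrami p ∈ orthoPoly hν m := fun _ hp =>
  ⟨polyBeltrami_mem_polyLE hp.1, fun q hq => by
    rw [polyInner_polyBeltrami hν]
    exact hp.2 _ (polyBeltrami_mem_polyLE hq)⟩

/-- The operator of the quadratic form `‖Δ ^ s p‖² + ‖Δ₀ ^ s p‖²`. -/
def energyOp (ν : ℝ) (s : ℕ) : Poly d →ₗ[ℝ] Poly d :=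
  laplacePowAdjoint s ν ∘ₗ (polyLaplace ^ s : Module.End ℝ (Poly d)) +
    (polyBeltrami ^ s * polyBeltrami ^ s : Module.End ℝ (Poly d))

theorem energyOp_apply (ν : ℝ) (s : ℕ) (p : Poly d) :
    energyOp ν s p = laplacePowAdjoint s ν (polyLaplace^[s] p) +
      polyBeltrami^[s] (polyBeltrami^[s] p) := by
  simp [energyOp, Module.End.pow_apply, Module.End.mul_apply]

/-- The bilinear form of an operator for the inner product with weight `ν`, on a space of
polynomials. -/
def operatorForm [NeZero d] {ν : ℝ} (hν : -1 < ν) (S : Poly d →ₗ[ℝ] Poly d)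
    (K : Submodule ℝ (Poly d)) : K →ₗ[ℝ] K →ₗ[ℝ] ℝ :=
  LinearMap.mk₂ ℝ (fun p q => polyInner ν (S p) (q : Poly d))
    (fun p q r => by rw [Submodule.coe_add, map_add, polyInner_add_left hν])
    (fun a p q => by rw [Submodule.coe_smul, map_smul, polyInner_smul_left, smul_eq_mul])
    (fun p q r => by
      rw [Submodule.coe_add, polyInner_comm, polyInner_add_left hν, polyInner_comm,
        polyInner_comm ν (r : Poly d)])
    (fun a p q => by
      rw [Submodule.coe_smul, polyInner_comm, polyInner_smul_left, polyInner_comm, smul_eq_mul])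

theorem operatorForm_apply [NeZero d] {ν : ℝ} (hν : -1 < ν) (S : Poly d →ₗ[ℝ] Poly d)
    (K : Submodule ℝ (Poly d)) (p q : K) :
    operatorForm hν S K p q = polyInner ν (S p) (q : Poly d) :=
  rfl

theorem polyInner_laplacePowAdjoint_polyLaplace [NeZero d] {ν : ℝ} (hν : -1 < ν) (s : ℕ)
    (p : Poly d) : polyInner ν (laplacePowAdjoint s ν (polyLaplace^[s] p)) p =
      polyInner (ν + 2 * s) (polyLaplace^[s] p) (polyLaplace^[s] p) := by
  rw [polyInner_polyLaplace_iterate hν, polyInner_comm]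

theorem exists_energyOp_eq_smul [NeZero d] {ν : ℝ} (hν : -1 < ν) {s m : ℕ}
    (hs : 1 ≤ s) (hm : 2 * s + 1 ≤ m) {v : Poly d} (hv : v ∈ orthoPoly hν m) (hv0 : v ≠ 0)
    {l : ℝ} (hl : polyBeltrami v = l • v) :
    ∃ σ, (spectralConst s * (m : ℝ) ^ 2) ^ (2 * s) ≤ σ ∧ energyOp ν s v = σ • v := by
  have hB : polyBeltrami v = -(-l) • v := by rw [neg_neg, hl]
  have hJ := jacobiOp_eq_smul_of_orthogonal hν (by omega) hv.1 hv.2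
  have h₁ := laplacePowAdjoint_polyLaplace_of_eigen s hJ hB
  have hpos : 0 < polyInner ν v v :=
    lt_of_le_of_ne (polyInner_self_nonneg ν _) fun h =>
      hv0 (eq_zero_of_integral_sq_eq_zero hν h.symm)
  -- The factor times `‖v‖²` equals `‖Δ^s v‖²`, so its sign needs no bound on `l`.
  have hR : 0 ≤ laplacePowFactor d s m ν (-l) := by
    have h₃ := polyInner_laplacePowAdjoint_polyLaplace hν s v
    rw [h₁, polyInner_smul_left] at h₃
    by_contra! hneg
    have := mul_neg_of_neg_of_pos hneg hpos
    linarith [polyInner_self_nonneg (ν + 2 * s) (polyLaplace^[s] v)]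
  refine ⟨laplacePowFactor d s m ν (-l) + (-l) ^ (2 * s),
    le_laplacePowFactor_add_pow NeZero.one_le hν hs hm hR, ?_⟩
  have h₄ : polyBeltrami^[s] (polyBeltrami^[s] v) = (-l) ^ (2 * s) • v := by
    rw [← Function.iterate_add_apply, ← two_mul, polyBeltrami_iterate_of_eigen _ hB, neg_neg,
      (even_two_mul s).neg_pow]
  rw [energyOp_apply, h₁, h₄, add_smul]

theorem mul_polyInner_le_of_eigen [NeZero d] {ν : ℝ} (hν : -1 < ν) (K : Submodule ℝ (Poly d))
    [FiniteDimensional ℝ K] (hK : ∀ p ∈ K, polyBeltrami p ∈ K) (S : Poly d →ₗ[ℝ] Poly d) {c : ℝ}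
    (h : ∀ v ∈ K, ∀ l : ℝ, v ≠ 0 → polyBeltrami v = l • v → ∃ σ, c ≤ σ ∧ S v = σ • v)
    {p : Poly d} (hp : p ∈ K) : c * polyInner ν p p ≤ polyInner ν (S p) p := by
  have hT : ∀ p q : K, (polyCore hν K).inner (polyBeltrami.restrict hK p) q =
      (polyCore hν K).inner p (polyBeltrami.restrict hK q) := fun p q =>
    polyInner_polyBeltrami hν (p : Poly d) q
  have hβ : ∀ (v : K) (l : ℝ), v ≠ 0 → polyBeltrami.restrict hK v = l • v →
      ∃ σ, c ≤ σ ∧ ∀ w, operatorForm hν S K v w = σ * (polyCore hν K).inner v w := by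
    intro v l hv hl
    obtain ⟨σ, hσ, h⟩ := h v v.2 l (fun h => hv (Subtype.ext h)) (congrArg Subtype.val hl)
    refine ⟨σ, hσ, fun w => ?_⟩
    rw [operatorForm_apply, h, polyInner_smul_left]
    rfl
  exact mul_inner_self_le_of_core (polyCore hν K) hT (operatorForm hν S K) hβ ⟨p, hp⟩

theorem pow_mul_polyInner_le_of_orthogonal [NeZero d] {ν : ℝ} (hν : -1 < ν) {s m : ℕ}
    (hs : 1 ≤ s) (hm : 2 * s + 1 ≤ m) {p : Poly d} (hp : p ∈ PolyLE d m)
    (ho : ∀ q ∈ PolyLE d (m - 1), polyInner ν p q = 0) :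
    (spectralConst s * (m : ℝ) ^ 2) ^ (2 * s) * polyInner ν p p ≤
      polyInner (ν + 2 * s) (polyLaplace^[s] p) (polyLaplace^[s] p) +
        polyInner ν (polyBeltrami^[s] p) (polyBeltrami^[s] p) := by
  have hle : orthoPoly (d := d) hν m ≤ PolyLE d m := fun p hp => hp.1
  have : FiniteDimensional ℝ (orthoPoly (d := d) hν m) := Submodule.finiteDimensional_of_le hle
  have hp' : p ∈ orthoPoly hν m := And.intro hp ho
  refine (mul_polyInner_le_of_eigen hν (orthoPoly hν m) (polyBeltrami_mem_orthoPoly hν m)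
    (energyOp ν s) (fun v hv l hv0 hl => exists_energyOp_eq_smul hν hs hm hv hv0 hl)
    hp').trans (le_of_eq ?_)
  rw [energyOp_apply, polyInner_add_left hν, polyInner_laplacePowAdjoint_polyLaplace hν,
    polyInner_polyBeltrami_iterate hν]

theorem polyInner_add_self [NeZero d] {ν : ℝ} (hν : -1 < ν) {p q : Poly d}
    (h : polyInner ν q p = 0) :
    polyInner ν (p + q) (p + q) = polyInner ν p p + polyInner ν q q := by
  rw [polyInner_add_left hν, polyInner_comm ν p, polyInner_comm ν q, polyInner_add_left hν,
    polyInner_add_left hν, h, polyInner_comm ν p q, h]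
  ring

theorem polyLaplace_iterate_add (s : ℕ) (p q : Poly d) :
    polyLaplace^[s] (p + q) = polyLaplace^[s] p + polyLaplace^[s] q := by
  simp only [← Module.End.pow_apply, map_add]

theorem polyBeltrami_iterate_add (s : ℕ) (p q : Poly d) :
    polyBeltrami^[s] (p + q) = polyBeltrami^[s] p + polyBeltrami^[s] q := by
  simp only [← Module.End.pow_apply, map_add]

theorem laplacePowAdjoint_polyLaplace_iterate_mem {s m : ℕ} (hm : 2 * s ≤ m) (ν : ℝ)
    {p : Poly d} (hp : p ∈ PolyLE d m) :
    laplacePowAdjoint s ν (polyLaplace^[s] p) ∈ PolyLE d m := by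
  have := laplacePowAdjoint_mem_polyLE s ν (polyLaplace_iterate_mem_polyLE s hp)
  rwa [Nat.sub_add_cancel hm] at this

/-- Induction on `N`, peeling off the part `v` of degree `N + 1`. Cross terms vanish because `(Δ^s)*
Δ^s` and `Δ₀^(2s)` map degree at most `N` into itself, and `v` is orthogonal to that space. At `N =
n` the polynomial is orthogonal to itself. -/
theorem pow_mul_polyInner_le [NeZero d] {ν : ℝ} (hν : -1 < ν) {s n N : ℕ} (hs : 1 ≤ s)
    (hn : 2 * s ≤ n) (hN : n ≤ N) {p : Poly d} (hp : p ∈ PolyLE d N)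
    (ho : ∀ q ∈ PolyLE d n, polyInner ν p q = 0) :
    (spectralConst s * (n : ℝ) ^ 2) ^ (2 * s) * polyInner ν p p ≤
      polyInner (ν + 2 * s) (polyLaplace^[s] p) (polyLaplace^[s] p) +
        polyInner ν (polyBeltrami^[s] p) (polyBeltrami^[s] p) := by
  induction N, hN using Nat.le_induction generalizing p with
  | base =>
    rw [ho p hp, mul_zero]
    exact add_nonneg (polyInner_self_nonneg _ _) (polyInner_self_nonneg _ _)
  | succ N hN ih =>
    obtain ⟨q, hq, hpq⟩ := polyInner_sub_left_eq_zero_of_best hν p N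
    set v := p - q with hv
    have hpv : p = q + v := by rw [hv]; abel
    have hvm : v ∈ PolyLE d (N + 1) := sub_mem hp (polyLE_mono N.le_succ hq)
    have h₁ := ih hq fun r hr => by
      rw [show q = p - v by rw [hv]; abel, polyInner_sub_left hν, ho r hr,
        hpq r (polyLE_mono hN hr), sub_zero]
    have h₂ := pow_mul_polyInner_le_of_orthogonal hν hs (m := N + 1) (by omega) hvm (by simpa using hpq)
    have hs0 : (0 : ℝ) ≤ s := s.cast_nonneg
    rw [hpv, polyLaplace_iterate_add, polyBeltrami_iterate_add, polyInner_add_self hν (hpq q hq),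
      polyInner_add_self (by linarith), polyInner_add_self hν]
    · have h₃ : (spectralConst s * (n : ℝ) ^ 2) ^ (2 * s) ≤
          (spectralConst s * ((N + 1 : ℕ) : ℝ) ^ 2) ^ (2 * s) := by
        have := (spectralConst_pos s).le
        have hnN : (n : ℝ) ≤ ((N + 1 : ℕ) : ℝ) := by exact_mod_cast hN.trans N.le_succ
        gcongr
      have h₄ := mul_le_mul_of_nonneg_right h₃ (polyInner_self_nonneg ν v)
      linarith
    · rw [polyInner_polyBeltrami_iterate hν]
      exact hpq _ (polyBeltrami_iterate_mem_polyLE s (polyBeltrami_iterate_mem_polyLE s hq))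
    · rw [polyInner_polyLaplace_iterate hν]
      exact hpq _ (laplacePowAdjoint_polyLaplace_iterate_mem (hn.trans hN) ν hq)

end Spectral

/-! ### The approximation theorem -/

section Approximation

variable {d : ℕ}

/-- Expand `0 ≤ ‖g - h‖²`: a function `h` with `⟨g, h⟩ = ‖h‖²` has norm at most that of `g`. -/
theorem integral_sq_le_of_integral_mul_eq {α : Type*} [MeasurableSpace α] {ρ : Measure α}
    {g h : α → ℝ} (hg : MemLp g 2 ρ) (hh : MemLp h 2 ρ)
    (hgh : ∫ x, g x * h x ∂ρ = ∫ x, h x * h x ∂ρ) :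
    ∫ x, h x * h x ∂ρ ≤ ∫ x, g x * g x ∂ρ := by
  have i₁ : Integrable (fun x => g x * g x) ρ := hg.integrable_mul hg
  have i₂ : Integrable (fun x => g x * h x) ρ := hg.integrable_mul hh
  have i₃ : Integrable (fun x => h x * h x) ρ := hh.integrable_mul hh
  have h₁ : 0 ≤ ∫ x, (g x - h x) * (g x - h x) ∂ρ := integral_nonneg fun x => mul_self_nonneg _
  have h₂ : ∫ x, (g x - h x) * (g x - h x) ∂ρ =
      ∫ x, (g x * g x - g x * h x) - (g x * h x - h x * h x) ∂ρ := by
    congr 1; ext x; ring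
  have h₃ : ∫ x, (g x * g x - g x * h x) - (g x * h x - h x * h x) ∂ρ =
      ∫ x, (g x * g x - g x * h x) ∂ρ - ∫ x, (g x * h x - h x * h x) ∂ρ :=
    integral_sub (i₁.sub i₂) (i₂.sub i₃)
  rw [h₂, h₃, integral_sub i₁ i₂, integral_sub i₂ i₃] at h₁
  linarith

theorem eLpNorm_two_eq {α : Type*} [MeasurableSpace α] {ρ : Measure α} {g : α → ℝ}
    (hg : MemLp g 2 ρ) : eLpNorm g 2 ρ = ENNReal.ofReal √(∫ x, g x * g x ∂ρ) := by
  rw [hg.eLpNorm_eq_integral_rpow_norm two_ne_zero ENNReal.ofNat_ne_top, Real.sqrt_eq_rpow]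
  simp [← pow_two]

theorem eLpNorm_sub_best_le [NeZero d] {ν : ℝ} (hν : -1 < ν) {f : Space d → ℝ}
    (hf : MemLp f 2 (weightMeasure d ν)) {n : ℕ} {p q : Poly d} (hp : p ∈ PolyLE d n)
    (h : ∀ q ∈ PolyLE d n, ∫ x, f x * polyFun q x ∂weightMeasure d ν = polyInner ν p q)
    (hq : q ∈ PolyLE d n) :
    eLpNorm (f - polyFun p) 2 (weightMeasure d ν) ≤
      eLpNorm (f - polyFun q) 2 (weightMeasure d ν) := by
  have hfp := hf.sub (memLp_polyFun hν p)
  have hfq := hf.sub (memLp_polyFun hν q)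
  rw [eLpNorm_two_eq hfp, eLpNorm_two_eq hfq]
  refine ENNReal.ofReal_le_ofReal (Real.sqrt_le_sqrt (integral_sq_le_of_integral_mul_eq hfq hfp ?_))
  have i₁ : Integrable (fun x => (f - polyFun q) x * (f - polyFun p) x) (weightMeasure d ν) :=
    hfq.integrable_mul hfp
  have i₂ : Integrable (fun x => (f - polyFun p) x * (f - polyFun p) x) (weightMeasure d ν) :=
    hfp.integrable_mul hfp
  rw [← sub_eq_zero, ← integral_sub i₁ i₂]
  have h₁ := h (p - q) (sub_mem hp hq)
  rw [polyInner, ← sub_eq_zero, ← integral_sub (integrable_mul_polyFun hν hf _)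
    (integrable_mul_polyFun hν (memLp_polyFun hν p) _)] at h₁
  rw [← h₁]
  congr 1; ext x
  simp only [Pi.sub_apply, map_sub]
  ring

theorem integral_sub_mul_polyFun [NeZero d] {ν : ℝ} (hν : -1 < ν) {f : Space d → ℝ}
    (hf : MemLp f 2 (weightMeasure d ν)) (p q : Poly d) :
    ∫ x, (f x - polyFun p x) * polyFun q x ∂weightMeasure d ν =
      ∫ x, f x * polyFun q x ∂weightMeasure d ν - polyInner ν p q := by
  simp only [sub_mul]
  exact integral_sub (integrable_mul_polyFun hν hf q)
    (integrable_mul_polyFun hν (memLp_polyFun hν p) q)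

theorem eLpNorm_sub_best_le_of_sob [NeZero d] {ν : ℝ} (hν : -1 < ν) {s n : ℕ} (hs : 1 ≤ s)
    (hn : 2 * s ≤ n) {f : Space d → ℝ} (hf : Sob (2 * s) ν f) {P : Poly d}
    (hP : P ∈ PolyLE d n)
    (hPf : ∀ q ∈ PolyLE d n, ∫ x, f x * polyFun q x ∂weightMeasure d ν = polyInner ν P q)
    {p₁ p₂ : Poly d} (h₁ : p₁ ∈ PolyLE d (n - 2 * s)) (h₂ : p₂ ∈ PolyLE d n)
    (hm : MemLp (laplaceBeltrami^[s] f) 2 (weightMeasure d ν)) :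
    eLpNorm (f - polyFun P) 2 (weightMeasure d ν) ≤
      ENNReal.ofReal ((spectralConst s ^ s)⁻¹ / (n : ℝ) ^ (2 * s)) *
        (eLpNorm (laplace^[s] f - polyFun p₁) 2 (weightMeasure d (ν + 2 * s)) +
          eLpNorm (laplaceBeltrami^[s] f - polyFun p₂) 2 (weightMeasure d ν)) := by
  have hs0 : (0 : ℝ) ≤ s := s.cast_nonneg
  have hν' : -1 < ν + 2 * s := by linarith
  have hfm := hf.memLp
  have hlm := hf.laplace_iterate s
  have hg₁ := hlm.sub (memLp_polyFun hν' p₁)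
  have hg₂ := hm.sub (memLp_polyFun hν p₂)
  have hn0 : (0 : ℝ) < n := by exact_mod_cast (by omega : 0 < n)
  have hδ := spectralConst_pos s
  set A := ∫ x, (laplace^[s] f - polyFun p₁) x * (laplace^[s] f - polyFun p₁) x
    ∂weightMeasure d (ν + 2 * s) with hA
  set B := ∫ x, (laplaceBeltrami^[s] f - polyFun p₂) x * (laplaceBeltrami^[s] f - polyFun p₂) x
    ∂weightMeasure d ν with hB
  have hA0 : 0 ≤ A := integral_nonneg fun x => mul_self_nonneg _
  have hB0 : 0 ≤ B := integral_nonneg fun x => mul_self_nonneg _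
  set c := spectralConst s ^ s * (n : ℝ) ^ (2 * s) with hc
  have hc0 : 0 < c := by positivity
  -- The bound does not depend on `N`, which allows the final passage from polynomials to `f`.
  have key : ∀ N, n ≤ N → ∀ Q ∈ PolyLE d N,
      (∀ q ∈ PolyLE d N, ∫ x, f x * polyFun q x ∂weightMeasure d ν = polyInner ν Q q) →
      √(polyInner ν (Q - P) (Q - P)) ≤ c⁻¹ * (√A + √B) := by
    intro N hN Q hQ hQf
    set w := Q - P with hw
    have hwN : w ∈ PolyLE d N := sub_mem hQ (polyLE_mono hN hP)
    have hwo : ∀ q ∈ PolyLE d n, polyInner ν w q = 0 := fun q hq => by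
      rw [hw, polyInner_sub_left hν, ← hPf q hq, ← hQf q (polyLE_mono hN hq), sub_self]
    have hwf : ∀ z ∈ PolyLE d N, polyInner ν P z = 0 →
        ∫ x, f x * polyFun z x ∂weightMeasure d ν = polyInner ν w z := fun z hz h0 => by
      rw [hQf z hz, hw, polyInner_sub_left hν, h0, sub_zero]
    -- Moving `Δ^s` to the other side, `p₁` drops out since `(Δ^s)* p₁` has degree at most `n - 2s +
    -- 2s = n`, and `f` may be replaced by `w` since `(Δ^s)* Δ^s w` has degree at most `N` and is
    -- orthogonal to `P`.
    have hA' : polyInner (ν + 2 * s) (polyLaplace^[s] w) (polyLaplace^[s] w) ≤ A := by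
      refine integral_sq_le_of_integral_mul_eq hg₁ (memLp_polyFun hν' _) ?_
      simp only [Pi.sub_apply]
      rw [integral_sub_mul_polyFun hν' hlm, polyInner_comm, polyInner_polyLaplace_iterate hν,
        hwo _ (by
          have := laplacePowAdjoint_mem_polyLE s ν h₁
          rwa [Nat.sub_add_cancel hn] at this),
        sub_zero, hf.integral_laplace_iterate_mul_polyFun hν, hwf _
          (laplacePowAdjoint_polyLaplace_iterate_mem (hn.trans hN) ν hwN)]
      · exact (polyInner_polyLaplace_iterate hν s w _).symm
      · rw [← polyInner_polyLaplace_iterate hν, polyInner_comm, polyInner_polyLaplace_iterate hν]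
        exact hwo _ (laplacePowAdjoint_polyLaplace_iterate_mem hn ν hP)
    have hB' : polyInner ν (polyBeltrami^[s] w) (polyBeltrami^[s] w) ≤ B := by
      refine integral_sq_le_of_integral_mul_eq hg₂ (memLp_polyFun hν _) ?_
      simp only [Pi.sub_apply]
      rw [integral_sub_mul_polyFun hν hm, polyInner_comm, polyInner_polyBeltrami_iterate hν,
        hwo _ (polyBeltrami_iterate_mem_polyLE s h₂), sub_zero,
        hf.integral_laplaceBeltrami_iterate_mul_polyFun hν s hm, hwf _
          (polyBeltrami_iterate_mem_polyLE s (polyBeltrami_iterate_mem_polyLE s hwN))]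
      · exact (polyInner_polyBeltrami_iterate hν s w _).symm
      · rw [← polyInner_polyBeltrami_iterate hν, ← polyInner_polyBeltrami_iterate hν,
          polyInner_comm]
        exact hwo _ (polyBeltrami_iterate_mem_polyLE s (polyBeltrami_iterate_mem_polyLE s hP))
    have h₃ := pow_mul_polyInner_le hν hs hn hN hwN hwo
    have h₄ : (spectralConst s * (n : ℝ) ^ 2) ^ (2 * s) = c ^ 2 := by
      rw [hc, mul_pow, mul_pow, ← pow_mul, ← pow_mul, ← pow_mul]
      congr 2 <;> ring
    rw [h₄] at h₃
    -- The spectral bound reads `c² ‖w‖² ≤ A + B`, and `A + B ≤ (√A + √B)²`.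
    have h₅ : polyInner ν w w ≤ (c⁻¹ * (√A + √B)) ^ 2 := by
      have e₁ := Real.sq_sqrt hA0
      have e₂ := Real.sq_sqrt hB0
      have e₃ := mul_nonneg (Real.sqrt_nonneg A) (Real.sqrt_nonneg B)
      rw [mul_pow, inv_pow, ← div_eq_inv_mul, le_div_iff₀ (by positivity)]
      nlinarith
    exact Real.sqrt_le_iff.2 ⟨by positivity, h₅⟩
  have hgoal : ENNReal.ofReal ((spectralConst s ^ s)⁻¹ / (n : ℝ) ^ (2 * s)) *
        (eLpNorm (laplace^[s] f - polyFun p₁) 2 (weightMeasure d (ν + 2 * s)) +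
          eLpNorm (laplaceBeltrami^[s] f - polyFun p₂) 2 (weightMeasure d ν)) =
      ENNReal.ofReal (c⁻¹ * (√A + √B)) := by
    rw [eLpNorm_two_eq hg₁, eLpNorm_two_eq hg₂,
      ← ENNReal.ofReal_add (Real.sqrt_nonneg _) (Real.sqrt_nonneg _),
      ← ENNReal.ofReal_mul (by positivity), hc, mul_inv, ← div_eq_mul_inv _ ((n : ℝ) ^ (2 * s))]
  rw [hgoal]
  refine ENNReal.le_of_forall_pos_le_add fun ε hε _ => ?_
  obtain ⟨q, hq⟩ := exists_eLpNorm_sub_polyFun_le hν hfm (ε := ε) (by exact_mod_cast hε)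
  -- `N` is large enough for both `key` and the approximant `q`; the projection `Q` is then at least
  -- as close to `f` as `q`.
  set N := max n q.totalDegree
  obtain ⟨Q, hQ, hQf⟩ := exists_best_approximation hν hfm N
  have h₃ := (eLpNorm_sub_best_le hν hfm hQ hQf (mem_polyLE.2 (le_max_right _ _))).trans hq
  have h₄ := ENNReal.ofReal_le_ofReal (key N (le_max_left _ _) Q hQ hQf)
  rw [polyInner, ← eLpNorm_two_eq (memLp_polyFun hν (Q - P))] at h₄
  calc eLpNorm (f - polyFun P) 2 (weightMeasure d ν)
      = eLpNorm (polyFun (Q - P) + (f - polyFun Q)) 2 (weightMeasure d ν) := by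
        congr 1; rw [map_sub]; abel
    _ ≤ _ := eLpNorm_add_le (memLp_polyFun hν _).aestronglyMeasurable
        (hfm.sub (memLp_polyFun hν Q)).aestronglyMeasurable (by norm_num)
    _ ≤ _ := add_le_add h₄ (h₃.trans (by simp))

end Approximation

end BallApprox

end

/-! ### Normalized norms and infima -/

theorem theorem1p1 (d : ℕ) (hd : 1 ≤ d) (μ : ℝ) (hμ : -1 < μ) (s : ℕ) (hs : 1 ≤ s) :
    ∃ c : ℝ, 0 < c ∧
      ∀ f : BallApprox.Space d → ℝ, BallApprox.MemSobolevBall (2 * s) μ f →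
        ∀ n : ℕ, 2 * s ≤ n →
          BallApprox.bestError n μ f ≤
            ENNReal.ofReal (c / (n : ℝ) ^ (2 * s)) *
              (BallApprox.bestError (n - 2 * s) (μ + 2 * s) (BallApprox.laplace^[s] f) +
                BallApprox.bestError n μ (BallApprox.laplaceBeltrami^[s] f)) := by
  open BallApprox in
  have : NeZero d := ⟨by omega⟩
  have hs0 : (0 : ℝ) ≤ s := s.cast_nonneg
  have hμ' : -1 < μ + 2 * s := by linarith
  set a := normConst d μ ^ (1 / 2 : ℝ) with ha
  set b := normConst d (μ + 2 * s) ^ (1 / 2 : ℝ) with hb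
  have ha0 : a ≠ 0 := by
    simp [ha, ENNReal.rpow_eq_zero_iff, normConst_ne_zero hμ, normConst_ne_top]
  have hat : a ≠ ∞ := ENNReal.rpow_ne_top_of_nonneg (by norm_num) (normConst_ne_top _)
  have hb0 : b ≠ 0 := by
    simp [hb, ENNReal.rpow_eq_zero_iff, normConst_ne_zero hμ', normConst_ne_top]
  have hbt : b ≠ ∞ := ENNReal.rpow_ne_top_of_nonneg (by norm_num) (normConst_ne_top _)
  have hab : a / b ≠ ∞ := ENNReal.div_ne_top hat hb0
  -- Compensates for the different normalizing constants of the weights `μ` and `μ + 2s`. The added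
  -- 1 gives `r ≥ 1`, so the same factor also serves the term with weight `μ`.
  set r := (a / b).toReal + 1 with hr
  have hr0 : 0 < r := by positivity
  have hra : ∀ e : ℝ≥0∞, a * e ≤ ENNReal.ofReal r * (b * e) := fun e => by
    have h : a / b ≤ ENNReal.ofReal r := by
      refine (ENNReal.ofReal_toReal hab).symm.le.trans (ENNReal.ofReal_le_ofReal ?_)
      rw [hr]
      linarith
    calc a * e = a / b * (b * e) := by rw [← mul_assoc, ENNReal.div_mul_cancel hb0 hbt]
      _ ≤ _ := by gcongr
  have hr1 : 1 ≤ ENNReal.ofReal r := by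
    rw [← ENNReal.ofReal_one]
    exact ENNReal.ofReal_le_ofReal (by rw [hr]; linarith [ENNReal.toReal_nonneg (a := a / b)])
  have hδ := spectralConst_pos s
  refine ⟨(spectralConst s ^ s)⁻¹ * r, by positivity, fun f hf n hn => ?_⟩
  have hn0 : (0 : ℝ) < n := by exact_mod_cast (by omega : 0 < n)
  have hS := hf.sob hμ
  have hk : ENNReal.ofReal ((spectralConst s ^ s)⁻¹ * r / (n : ℝ) ^ (2 * s)) =
      ENNReal.ofReal ((spectralConst s ^ s)⁻¹ / (n : ℝ) ^ (2 * s)) * ENNReal.ofReal r := by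
    rw [← ENNReal.ofReal_mul (by positivity)]
    congr 1; ring
  set k := ENNReal.ofReal ((spectralConst s ^ s)⁻¹ * r / (n : ℝ) ^ (2 * s)) with hkdef
  have hk0 : k ≠ 0 := by
    rw [hkdef, Ne, ENNReal.ofReal_eq_zero, not_le]; positivity
  have hkt : k ≠ ∞ := ENNReal.ofReal_ne_top
  suffices h : ∀ p₁ : Poly d, p₁.totalDegree ≤ n - 2 * s → ∀ p₂ : Poly d, p₂.totalDegree ≤ n →
      bestError n μ f ≤ k * (ballNorm (μ + 2 * s) (laplace^[s] f - polyFun p₁) +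
        ballNorm μ (laplaceBeltrami^[s] f - polyFun p₂)) by
    rw [← ENNReal.div_le_iff' hk0 hkt]
    unfold bestError
    refine ENNReal.le_iInf₂_add_iInf₂ fun p₁ h₁ p₂ h₂ => ?_
    rw [ENNReal.div_le_iff' hk0 hkt]
    exact h p₁ h₁ p₂ h₂
  intro p₁ h₁ p₂ h₂
  -- The hypotheses place `Δ₀^s f` only in the space with weight `μ + 2s`. If it is not square
  -- integrable for the weight `μ`, the right-hand side is infinite; otherwise the estimate above
  -- applies.
  by_cases htop : eLpNorm (laplaceBeltrami^[s] f - polyFun p₂) 2 (weightMeasure d μ) = ∞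
  · rw [ballNorm_eq hμ (laplaceBeltrami^[s] f - polyFun p₂), htop, ENNReal.mul_top ha0, add_top,
      ENNReal.mul_top hk0]
    exact le_top
  · have hm : MemLp (laplaceBeltrami^[s] f) 2 (weightMeasure d μ) := by
      have h₃ : MemLp (laplaceBeltrami^[s] f - polyFun p₂) 2 (weightMeasure d μ) :=
        ⟨(hS.aestronglyMeasurable_laplaceBeltrami_iterate s).sub
          (memLp_polyFun hμ p₂).aestronglyMeasurable, lt_top_iff_ne_top.2 htop⟩
      simpa using h₃.add (memLp_polyFun hμ p₂)
    obtain ⟨P, hP, hPf⟩ := exists_best_approximation hμ hS.memLp n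
    have h₃ := eLpNorm_sub_best_le_of_sob hμ hs hn hS hP hPf (mem_polyLE.2 h₁) (mem_polyLE.2 h₂) hm
    have h₄ : bestError n μ f ≤ ballNorm μ (f - polyFun P) :=
      iInf₂_le P (mem_polyLE.1 hP)
    refine h₄.trans ?_
    rw [ballNorm_eq hμ, ballNorm_eq hμ, ballNorm_eq hμ', ← ha, ← hb, hk, mul_assoc]
    calc a * eLpNorm (f - polyFun P) 2 (weightMeasure d μ) ≤ a * _ := by gcongr
      _ = _ := mul_left_comm _ _ _
      _ ≤ _ := by
        refine mul_le_mul' le_rfl ?_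
        rw [mul_add, mul_add]
        exact add_le_add (hra _) (le_mul_of_one_le_left zero_le hr1)
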